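/- **Setting.** Let $n\ge 1$ and let $(M,L)$ be a Finsler spacetime of dimension $n+1$: $M$ is a connected $C^\infty$-manifold (Hausdorff, second countable, without boundary), $L\colon TM\to\mathbb R$ is $C^\infty$ on $TM\setminus\{0\}$, satisfies $L(cv)=c^2L(v)$ for $c>0$, and for every $v\ne0$ the matrix $g_{\alpha\beta}(v)=\partial^2L/\partial v^\alpha\partial v^\beta(v)$ has signature $(-,+,\dots,+)$ (it defines the bilinear form $g_v$), and $M$ carries a smooth vector field $X$ with $L(X)<0$ everywhere. A causal vector ($v\ne 0$, $L(v)\le 0$) in $T_xM$ is future-directed if it lies in the same connected component of $\overline{\{L<0\}\cap T_xM}\setminus\{0\}$ as $X(x)$; $\Omega_x$ is the set of future-directed vectors in $T_xM$ with $L<0$, and causal curves are future-directed. Let $\psi\colon\overline\Omega\setminus\{0\}=\bigcup_x(\overline{\Omega_x}\setminus\{0\})\to\mathbb R$ be $C^\infty$ and positively $0$-homogeneous. In local coordinates, with summation over repeated indices, put $\widetilde\Gamma^\alpha_{\beta\gamma}=\frac12g^{\alpha\delta}(\partial_{x^\beta}g_{\delta\gamma}+\partial_{x^\gamma}g_{\beta\delta}-\partial_{x^\delta}g_{\beta\gamma})$,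 $G^\alpha=\frac12\widetilde\Gamma^\alpha_{\beta\gamma}v^\beta v^\gamma$, $N^\alpha_\beta=\partial G^\alpha/\partial v^\beta$, and $\Gamma^\alpha_{\beta\gamma}=\widetilde\Gamma^\alpha_{\beta\gamma}-\frac12g^{\alpha\delta}(\partial_{v^\mu}g_{\delta\gamma}N^\mu_\beta+\partial_{v^\mu}g_{\beta\delta}N^\mu_\gamma-\partial_{v^\mu}g_{\beta\gamma}N^\mu_\delta)$. Geodesics are the smooth causal curves with $\ddot\eta^\alpha+\widetilde\Gamma^\alpha_{\beta\gamma}(\dot\eta)\dot\eta^\beta\dot\eta^\gamma=0$; the covariant derivative along $\eta$ of a vector field $Y$ is $(Y')^\alpha=\dot Y^\alpha+\Gamma^\alpha_{\beta\gamma}(\dot\eta)\dot\eta^\beta Y^\gamma$, and endomorphism fields are differentiated by $E'(P)=E(P)'-E(P')$. The curvature endomorphism $R_v$ has the matrix $R^\alpha_\beta=2\partial_{x^\beta}G^\alpha-(\partial_{x^\gamma}N^\alpha_\beta v^\gamma-2\,\partial_{v^\gamma}N^\alpha_\beta\,G^\gamma)-N^\alpha_\gamma N^\gamma_\beta$, and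 $\mathrm{Ric}(v)=\operatorname{trace}R_v$. For a geodesic $\eta$ let $\psi_\eta(t)=\psi(\dot\eta(t))$. If $\eta$ is the geodesic with $\dot\eta(0)=v$, then $\mathrm{Ric}_N(v)=\mathrm{Ric}(v)+\psi_\eta''(0)-\psi_\eta'(0)^2/(N-n)$ for $N\in\mathbb R\setminus\{n\}$, $\mathrm{Ric}_\infty(v)=\mathrm{Ric}(v)+\psi_\eta''(0)$, and $\mathrm{Ric}_n(v)$ equals $\mathrm{Ric}(v)+\psi_\eta''(0)$ if $\psi_\eta'(0)=0$ and $-\infty$ otherwise. Let $\eta\colon(a,b)\to M$, $-\infty\le a<b\le\infty$, be a timelike geodesic of unit speed ($L(\dot\eta)\equiv-\frac12$), and let $N_\eta(t)=\{w\in T_{\eta(t)}M: g_{\dot\eta(t)}(\dot\eta(t),w)=0\}$. A *Lagrange tensor field* along $\eta$ is a smooth field of endomorphisms $\mathsf J(t)$ of $N_\eta(t)$ with $\mathsf J''+R_{\dot\eta}\mathsf J=0$, $\ker\mathsf J(t)\cap\ker\mathsf J'(t)=\{0\}$, and $(\mathsf J')^{\mathsf T}\mathsf J-\mathsf J^{\mathsf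 T}\mathsf J'=0$, where $\mathsf T$ is the $g_{\dot\eta}$-transpose. For $\epsilon\in\mathbb R$ let $\tau_\epsilon$ be a primitive of $e^{\frac{2(\epsilon-1)}n\psi_\eta}$ on $(a,b)$ and let $*$ denote (covariant) differentiation in $\tau_\epsilon$, so that $\eta^*=e^{\frac{2(1-\epsilon)}n\psi_\eta}\dot\eta$ and $\psi_\eta^*=e^{\frac{2(1-\epsilon)}n\psi_\eta}\psi_\eta'$. Where $\mathsf J(t)$ is invertible, let $$\mathsf B_\epsilon=e^{\frac{2(1-\epsilon)}n\psi_\eta}\,\mathsf J'\mathsf J^{-1}-\frac{\psi_\eta^*}{n}I_n,\qquad \theta_\epsilon=\operatorname{trace}\mathsf B_\epsilon .$$ **Proposition.** Let $N\in(-\infty,0]\cup[n,+\infty]$ and let $\epsilon\in\mathbb R$ satisfy $\epsilon=0$ if $N=0$, and $|\epsilon|<\sqrt{N/(N-n)}$ if $N\ne0$ (the right-hand side being $1$ for $N=\infty$ and $+\infty$ for $N=n$). Let $$c=c(N,\epsilon)=\frac1n\Bigl(1-\epsilon^2\frac{N-n}{N}\Bigr),\qquad c(0,0)=\frac1n,\qquad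 c(\infty,\epsilon)=\frac{1-\epsilon^2}{n}.$$ Assume that $\mathrm{Ric}_N(\eta^*)\ge0$ on $(a,b)$, and let $\mathsf J$ be a Lagrange tensor field along $\eta$ that is invertible at some $t_0\in(a,b)$. Then $c>0$ and the following hold. 1. If $\theta_\epsilon(t_0)<0$, put $s_0=\tau_\epsilon^{-1}\bigl(\tau_\epsilon(t_0)-\frac1{c\,\theta_\epsilon(t_0)}\bigr)-t_0$. If this is defined with $t_0+s_0<b$ (that is, $\tau_\epsilon(t_0)-\frac1{c\,\theta_\epsilon(t_0)}$ is a value of $\tau_\epsilon$ on $(a,b)$), then $\det\mathsf J(t)=0$ for some $t\in[t_0,t_0+s_0]$. 2. If $\theta_\epsilon(t_0)>0$ and, for $s_0$ given by the same formula, $t_0+s_0>a$ (in the same sense), then $\det\mathsf J(t)=0$ for some $t\in[t_0+s_0,t_0]$. -/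

import Mathlib

open Set Filter Topology Manifold ContDiff

noncomputable section

namespace LorentzFinsler

/-- The model space of a manifold of dimension `n + 1`; indices run over `0, 1, …, n`. -/
abbrev Model (n : ℕ) : Type := EuclideanSpace ℝ (Fin (n + 1))

/-! ### Coordinate expressions

A point of `Model n × Model n` is a pair `(x, v)`: the coordinates `(x^α)` of a point together with
the fibrewise linear coordinates `(v^α)` of a tangent vector at that point. The function
`Λ : Model n × Model n → ℝ` is the coordinate expression of a Lagrangian. -/

section Coordinates

variable {n : ℕ}

/-- The partial derivative `∂f/∂x^α`. -/
def pdx (α : Fin (n + 1)) (f : Model n × Model n → ℝ) (p : Model n × Model n) : ℝ :=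
  fderiv ℝ f p (EuclideanSpace.single α 1, 0)

/-- The partial derivative `∂f/∂v^α`. -/
def pdv (α : Fin (n + 1)) (f : Model n × Model n → ℝ) (p : Model n × Model n) : ℝ :=
  fderiv ℝ f p (0, EuclideanSpace.single α 1)

/-- `g_{αβ} = ∂²L/∂v^α∂v^β`. -/
def gMat (Λ : Model n × Model n → ℝ) (p : Model n × Model n) :
    Matrix (Fin (n + 1)) (Fin (n + 1)) ℝ :=
  Matrix.of fun α β => pdv α (pdv β Λ) p

/-- The inverse matrix `g^{αβ}`. -/
def gInv (Λ : Model n × Model n → ℝ) (p : Model n × Model n) :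
    Matrix (Fin (n + 1)) (Fin (n + 1)) ℝ :=
  (gMat Λ p)⁻¹

/-- The formal Christoffel symbols
`Γ̃^α_{βγ} = ½ g^{αδ} (∂g_{δγ}/∂x^β + ∂g_{βδ}/∂x^γ - ∂g_{βγ}/∂x^δ)`. -/
def christoffelTilde (Λ : Model n × Model n → ℝ) (α β γ : Fin (n + 1))
    (p : Model n × Model n) : ℝ :=
  (1 / 2) * ∑ δ, gInv Λ p α δ *
    (pdx β (fun q => gMat Λ q δ γ) p + pdx γ (fun q => gMat Λ q β δ) p
      - pdx δ (fun q => gMat Λ q β γ) p)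

/-- The geodesic spray coefficients `G^α = ½ Γ̃^α_{βγ} v^β v^γ`. -/
def spray (Λ : Model n × Model n → ℝ) (α : Fin (n + 1)) (p : Model n × Model n) : ℝ :=
  (1 / 2) * ∑ β, ∑ γ, christoffelTilde Λ α β γ p * p.2 β * p.2 γ

/-- The nonlinear connection `N^α_β = ∂G^α/∂v^β`. -/
def nonlinConn (Λ : Model n × Model n → ℝ) (α β : Fin (n + 1)) (p : Model n × Model n) : ℝ :=
  pdv β (spray Λ α) p

/-- The connection coefficients `Γ^α_{βγ}` defining covariant derivatives. -/
def christoffel (Λ : Model n × Model n → ℝ) (α β γ : Fin (n + 1))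
    (p : Model n × Model n) : ℝ :=
  christoffelTilde Λ α β γ p -
    (1 / 2) * ∑ δ, ∑ μ, gInv Λ p α δ *
      (pdv μ (fun q => gMat Λ q δ γ) p * nonlinConn Λ μ β p
        + pdv μ (fun q => gMat Λ q β δ) p * nonlinConn Λ μ γ p
        - pdv μ (fun q => gMat Λ q β γ) p * nonlinConn Λ μ δ p)

/-- The matrix `ω^α_γ = Γ^α_{βγ}(v) v^β`; along a curve with velocity `v`, the covariant derivative
of a vector field `X` is `Ẋ^α + ω^α_γ X^γ`. -/
def connMat (Λ : Model n × Model n → ℝ) (p : Model n × Model n) :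
    Matrix (Fin (n + 1)) (Fin (n + 1)) ℝ :=
  Matrix.of fun α γ => ∑ β, christoffel Λ α β γ p * p.2 β

/-- The curvature coefficients
`R^α_β = 2 ∂G^α/∂x^β - (∂N^α_β/∂x^γ v^γ - 2 ∂N^α_β/∂v^γ G^γ) - N^α_γ N^γ_β`. -/
def curvMat (Λ : Model n × Model n → ℝ) (p : Model n × Model n) :
    Matrix (Fin (n + 1)) (Fin (n + 1)) ℝ :=
  Matrix.of fun α β =>
    2 * pdx β (spray Λ α) p
      - ∑ γ, (pdx γ (nonlinConn Λ α β) p * p.2 γ - 2 * pdv γ (nonlinConn Λ α β) p * spray Λ γ p)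
      - ∑ γ, nonlinConn Λ α γ p * nonlinConn Λ γ β p

end Coordinates

/-! ### Lorentz–Finsler structures on a manifold -/

section Manifold

variable {n : ℕ} {M : Type*} [TopologicalSpace M] [ChartedSpace (Model n) M]
  [IsManifold (𝓡 (n + 1)) ∞ M]

/-- `T_xM` with the (smooth) model with corners of a boundaryless `(n+1)`-manifold. -/
abbrev Tan (n : ℕ) {M : Type*} [TopologicalSpace M] [ChartedSpace (Model n) M] (x : M) : Type :=
  TangentSpace (𝓡 (n + 1)) x

/-- The tangent bundle `TM`. -/
abbrev TM (n : ℕ) (M : Type*) [TopologicalSpace M] [ChartedSpace (Model n) M] : Type _ :=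
  TangentBundle (𝓡 (n + 1)) M

/-- `tanCoord x₀ x w` is the vector `(w^α)` of components of `w ∈ T_xM` in the chart around `x₀`
(for `x` in the domain of that chart). -/
def tanCoord (x₀ x : M) : Tan n x →L[ℝ] Model n :=
  (trivializationAt (Model n) (TangentSpace (𝓡 (n + 1))) x₀).continuousLinearMapAt ℝ x

/-- The inverse of `tanCoord x₀ x`: it sends `(w^α)` to `∑ w^α ∂/∂x^α|_x`. -/
def tanCoordInv (x₀ x : M) : Model n →L[ℝ] Tan n x :=
  (trivializationAt (Model n) (TangentSpace (𝓡 (n + 1))) x₀).symmL ℝ x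

/-- The coordinates `(x^α, v^α)` of a tangent vector in the chart around `x₀`. -/
def coords (x₀ : M) (v : TM n M) : Model n × Model n :=
  (extChartAt (𝓡 (n + 1)) x₀ v.1, tanCoord x₀ v.1 v.2)

/-- The coordinate expression of `L : TM → ℝ` in the chart around `x₀`. -/
def localRep (L : TM n M → ℝ) (x₀ : M) (p : Model n × Model n) : ℝ :=
  L ⟨(extChartAt (𝓡 (n + 1)) x₀).symm p.1, tanCoordInv x₀ ((extChartAt (𝓡 (n + 1)) x₀).symm p.1) p.2⟩

/-- The symmetric bilinear form `g_v(a, b) = ∑ a^α b^β g_{αβ}(v)` on `T_xM`, for `v ∈ T_xM`. -/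
def gForm (L : TM n M → ℝ) (v : TM n M) : Tan n v.1 →ₗ[ℝ] Tan n v.1 →ₗ[ℝ] ℝ :=
  LinearMap.mk₂ ℝ
    (fun a b => ∑ α, ∑ β, tanCoord v.1 v.1 a α * tanCoord v.1 v.1 b β *
      gMat (localRep L v.1) (coords v.1 v) α β)
    (fun a a' b => by simp [add_mul, Finset.sum_add_distrib])
    (fun c a b => by simp [Finset.mul_sum, mul_assoc])
    (fun a b b' => by simp [mul_add, add_mul, Finset.sum_add_distrib])
    (fun c a b => by simp [Finset.mul_sum, mul_assoc, mul_left_comm])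

/-- The curvature endomorphism `R_v : T_xM → T_xM`, for `v ∈ T_xM`. -/
def curvEndo (L : TM n M → ℝ) (v : TM n M) : Tan n v.1 →ₗ[ℝ] Tan n v.1 :=
  (tanCoordInv v.1 v.1).toLinearMap ∘ₗ
    Matrix.toEuclideanLin (curvMat (localRep L v.1) (coords v.1 v)) ∘ₗ
      (tanCoord v.1 v.1).toLinearMap

/-- The Ricci curvature `Ric(v) = trace R_v`. -/
def ricci (L : TM n M → ℝ) (v : TM n M) : ℝ :=
  LinearMap.trace ℝ (Tan n v.1) (curvEndo L v)

/-- A Finsler spacetime: a Lorentz–Finsler structure `L` on `M` in the sense of Beem, together with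
a smooth timelike vector field `T` giving the time orientation. -/
structure FinslerSpacetime (n : ℕ) (M : Type*) [TopologicalSpace M] [ChartedSpace (Model n) M]
    [IsManifold (𝓡 (n + 1)) ∞ M] where
  /-- the Lagrangian -/
  L : TM n M → ℝ
  smooth : ContMDiffOn (𝓡 (n + 1)).tangent 𝓘(ℝ, ℝ) ∞ L {v | v.2 ≠ 0}
  homogeneous : ∀ (v : TM n M) (c : ℝ), 0 < c → L ⟨v.1, c • v.2⟩ = c ^ 2 * L v
  signature : ∀ v : TM n M, v.2 ≠ 0 →
    ∃ b : Module.Basis (Fin (n + 1)) ℝ (Tan n v.1), ∀ i j,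
      gForm L v (b i) (b j) = if i = j then (if i = 0 then -1 else 1) else 0
  /-- the time orientation -/
  T : (x : M) → Tan n x
  T_smooth : ContMDiff (𝓡 (n + 1)) (𝓡 (n + 1)).tangent ∞ fun x => (⟨x, T x⟩ : TM n M)
  T_timelike : ∀ x, L ⟨x, T x⟩ < 0

namespace FinslerSpacetime

variable (S : FinslerSpacetime n M)

/-- The set `Ω'_x` of timelike vectors at `x`. -/
def timelike (x : M) : Set (Tan n x) := {w | S.L ⟨x, w⟩ < 0}

/-- `v` is a future-directed causal vector: it is causal and lies in the same connected component
of `closure Ω'_x \ {0}` as the time orientation. -/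
def IsFutureCausal (v : TM n M) : Prop :=
  S.L v ≤ 0 ∧ v.2 ≠ 0 ∧
    v.2 ∈ connectedComponentIn (closure (S.timelike v.1) \ {0}) (S.T v.1)

/-- The set `Ω_x` of future-directed timelike vectors at `x`. -/
def futureTimelike (x : M) : Set (Tan n x) :=
  {w | S.L ⟨x, w⟩ < 0 ∧ S.IsFutureCausal ⟨x, w⟩}

/-- A weight function: a `C^∞`, positively `0`-homogeneous function on the set
`Ω̄ \ {0} = ⋃ₓ closure Ω_x \ {0}` (the values of `ψ` elsewhere are irrelevant). -/
def IsWeight (ψ : TM n M → ℝ) : Prop :=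
  ContMDiffOn (𝓡 (n + 1)).tangent 𝓘(ℝ, ℝ) ∞ ψ
      {v | v.2 ∈ closure (S.futureTimelike v.1) ∧ v.2 ≠ 0} ∧
    ∀ v : TM n M, v.2 ∈ closure (S.futureTimelike v.1) → v.2 ≠ 0 →
      ∀ c : ℝ, 0 < c → ψ ⟨v.1, c • v.2⟩ = ψ v

/-- The open interval `(a, b)` with possibly infinite end points. -/
def interval (a b : EReal) : Set ℝ := {t | a < (t : EReal) ∧ (t : EReal) < b}

/-- The velocity `η̇(t) ∈ TM` of a curve. -/
def velocity (η : ℝ → M) (t : ℝ) : TM n M :=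
  ⟨η t, mfderiv 𝓘(ℝ, ℝ) (𝓡 (n + 1)) η t (1 : ℝ)⟩

/-- `η` is a (future-directed) causal geodesic on `(a, b)`: a smooth causal curve with
`η̈^α + Γ̃^α_{βγ}(η̇) η̇^β η̇^γ = 0` in every chart. -/
def IsCausalGeodesic (η : ℝ → M) (a b : EReal) : Prop :=
  ContMDiffOn 𝓘(ℝ, ℝ) (𝓡 (n + 1)) ∞ η (interval a b) ∧
  (∀ t ∈ interval a b, S.IsFutureCausal (velocity (n := n) η t)) ∧
  ∀ x₀ : M, ∀ t ∈ interval a b, η t ∈ (chartAt (Model n) x₀).source → ∀ α : Fin (n + 1),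
    HasDerivAt (fun s => (coords x₀ (velocity (n := n) η s)).2 α)
      (-∑ β, ∑ γ, christoffelTilde (localRep S.L x₀) α β γ (coords x₀ (velocity (n := n) η t)) *
        (coords x₀ (velocity (n := n) η t)).2 β * (coords x₀ (velocity (n := n) η t)).2 γ) t

/-- `η` is a (future-directed) timelike geodesic of unit speed, `F(η̇) = √(-2L(η̇)) = 1`. -/
def IsUnitTimelikeGeodesic (η : ℝ → M) (a b : EReal) : Prop :=
  S.IsCausalGeodesic η a b ∧
    ∀ t ∈ interval a b, S.L (velocity (n := n) η t) < 0 ∧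
      Real.sqrt (-2 * S.L (velocity (n := n) η t)) = 1

/-- The weight along a curve, `ψ_η(t) = ψ(η̇(t))`. -/
def weightAlong (ψ : TM n M → ℝ) (η : ℝ → M) (t : ℝ) : ℝ := ψ (velocity (n := n) η t)

/-- `r` is the weighted Ricci curvature `Ric_N(v)`: with `η` the geodesic such that `η̇(0) = v`,
`r = Ric(v) + ψ_η''(0) - ψ_η'(0)² / (N - n)` for real `N ≠ n`, with the limiting cases `N = ∞` and
`N = n` (the value `-∞` is possible in the latter). -/
def IsWeightedRicci (ψ : TM n M → ℝ) (N : WithTop ℝ) (v : TM n M) (r : EReal) : Prop :=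
  ∃ (δ : ℝ) (η : ℝ → M), 0 < δ ∧ S.IsCausalGeodesic η ((-δ : ℝ) : EReal) (δ : EReal) ∧
    velocity η 0 = v ∧
    r = match N with
      | ⊤ => ((ricci S.L v + deriv (deriv (weightAlong (n := n) ψ η)) 0 : ℝ) : EReal)
      | (N : ℝ) =>
        if N = n then
          if deriv (weightAlong (n := n) ψ η) 0 = 0 then
            ((ricci S.L v + deriv (deriv (weightAlong (n := n) ψ η)) 0 : ℝ) : EReal)
          else ⊥
        else
          ((ricci S.L v + deriv (deriv (weightAlong (n := n) ψ η)) 0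
            - deriv (weightAlong (n := n) ψ η) 0 ^ 2 / (N - n) : ℝ) : EReal)

/-- `Ric_N(v) ≥ 0`. -/
def WeightedRicciNonneg (ψ : TM n M → ℝ) (N : WithTop ℝ) (v : TM n M) : Prop :=
  ∀ r : EReal, S.IsWeightedRicci ψ N v r → 0 ≤ r

/-! ### Tensor fields along a geodesic -/

/-- The subspace of `T_xM` that is `g_v`-orthogonal to `v ∈ T_xM`. -/
def orth (v : TM n M) : Submodule ℝ (Tan n v.1) := LinearMap.ker (gForm S.L v v.2)

/-- The `g_v`-orthogonal projection `w ↦ w - (g_v(v,w) / g_v(v,v)) v` of `T_xM` onto `orth v`,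
for `v` timelike (and `0` in the irrelevant case `g_v(v,v) = 0`). -/
def orthProj (v : TM n M) : Tan n v.1 →ₗ[ℝ] S.orth v :=
  open Classical in
  if h : gForm S.L v v.2 v.2 ≠ 0 then
    LinearMap.codRestrict (S.orth v)
      (LinearMap.id - ((gForm S.L v v.2 v.2)⁻¹ • gForm S.L v v.2).smulRight v.2)
      (fun w => by
        simp only [orth, LinearMap.mem_ker, LinearMap.sub_apply, LinearMap.id_apply,
          LinearMap.smulRight_apply, LinearMap.smul_apply, map_sub, map_smul, smul_eq_mul]
        field_simp
        simp)
  else 0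

/-- A family of endomorphisms `A(t) : N_η(t) → N_η(t)`, where `N_η(t)` is the subspace orthogonal to
`η̇(t)`. -/
abbrev OrthEndo (η : ℝ → M) : Type _ :=
  (t : ℝ) → Module.End ℝ (S.orth (velocity (n := n) η t))

/-- The components, in the chart around `x₀`, of the `(1,1)`-tensor on `T_{η(t)}M` that equals `A(t)`
on `N_η(t)` and vanishes on `η̇(t)`. -/
def endoMat {η : ℝ → M} (A : S.OrthEndo η) (x₀ : M) (t : ℝ) :
    Matrix (Fin (n + 1)) (Fin (n + 1)) ℝ :=
  Matrix.of fun α β =>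
    tanCoord x₀ (η t)
      (A t (S.orthProj (velocity η t) (tanCoordInv x₀ (η t) (EuclideanSpace.single β 1)))).1 α

/-- `A` is a smooth tensor field along `η` on `(a, b)`. -/
def IsSmoothEndo {η : ℝ → M} (a b : EReal) (A : S.OrthEndo η) : Prop :=
  ∀ x₀ : M, ∀ α β : Fin (n + 1), ContDiffOn ℝ ∞ (fun t => S.endoMat A x₀ t α β)
    {t | t ∈ interval a b ∧ η t ∈ (chartAt (Model n) x₀).source}

/-- `A'` is the covariant derivative of `A` along `η`. In every chart this is the usual formula
`(A')^α_β = d/dt A^α_β + ω^α_γ A^γ_β - A^α_γ ω^γ_β` with `ω^α_γ = Γ^α_{βγ}(η̇) η̇^β`, which is the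
coordinate form of `A'(P) = A(P)' - A(P')` for vector fields `P` along `η`; covariant
differentiation along a geodesic preserves the tensors that vanish on `η̇` and map into `N_η`. -/
def HasCovDeriv {η : ℝ → M} (a b : EReal) (A A' : S.OrthEndo η) : Prop :=
  ∀ x₀ : M, ∀ t ∈ interval a b, η t ∈ (chartAt (Model n) x₀).source → ∀ α β : Fin (n + 1),
    HasDerivAt (fun s => S.endoMat A x₀ s α β)
      (S.endoMat A' x₀ t α β -
        (connMat (localRep S.L x₀) (coords x₀ (velocity (n := n) η t)) * S.endoMat A x₀ t) α β +
        (S.endoMat A x₀ t * connMat (localRep S.L x₀) (coords x₀ (velocity (n := n) η t))) α β) t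

/-- `J`, with covariant derivative `J'`, is a Jacobi tensor field along `η` on `(a, b)`:
`J'' + R J = 0` and `ker J(t) ∩ ker J'(t) = {0}`. -/
def IsJacobiTensor {η : ℝ → M} (a b : EReal) (J J' : S.OrthEndo η) : Prop :=
  S.IsSmoothEndo a b J ∧ S.HasCovDeriv a b J J' ∧
  (∃ J'' : S.OrthEndo η, S.HasCovDeriv a b J' J'' ∧
    ∀ t ∈ interval a b, ∀ w : S.orth (velocity (n := n) η t),
      (J'' t w).1 + curvEndo S.L (velocity η t) (J t w).1 = 0) ∧
  ∀ t ∈ interval a b, LinearMap.ker (J t) ⊓ LinearMap.ker (J' t) = ⊥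

/-- `J`, with covariant derivative `J'`, is a Lagrange tensor field along `η` on `(a, b)`: a Jacobi
tensor field with `(J')ᵀ J - Jᵀ J' = 0`, the transpose being taken with respect to `g_η̇`. -/
def IsLagrangeTensor {η : ℝ → M} (a b : EReal) (J J' : S.OrthEndo η) : Prop :=
  S.IsJacobiTensor a b J J' ∧
  ∀ t ∈ interval a b, ∀ w₁ w₂ : S.orth (velocity (n := n) η t),
    gForm S.L (velocity η t) (J' t w₁).1 (J t w₂).1
      - gForm S.L (velocity η t) (J t w₁).1 (J' t w₂).1 = 0

/-- `B = J' J⁻¹` (at the parameters where `J` is invertible). -/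
def endoB {η : ℝ → M} (J J' : S.OrthEndo η) : S.OrthEndo η :=
  fun t => J' t * Ring.inverse (J t)

/-- The derivative `ψ_η^* = e^{2(1-ε)ψ_η/n} ψ_η'` with respect to the `ε`-proper time. -/
def weightStar (ψ : TM n M → ℝ) (ε : ℝ) (η : ℝ → M) (t : ℝ) : ℝ :=
  Real.exp (2 * (1 - ε) / n * weightAlong (n := n) ψ η t) * deriv (weightAlong (n := n) ψ η) t

/-- `η^*(t) = e^{2(1-ε)ψ_η(t)/n} η̇(t)`, the velocity with respect to the `ε`-proper time. -/
def velocityStar (ψ : TM n M → ℝ) (ε : ℝ) (η : ℝ → M) (t : ℝ) : TM n M :=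
  ⟨η t, Real.exp (2 * (1 - ε) / n * weightAlong (n := n) ψ η t) • (velocity (n := n) η t).2⟩

/-- `B_ε = e^{2(1-ε)ψ_η/n} B - (ψ_η^*/n) I`. -/
def endoBEps (ψ : TM n M → ℝ) (ε : ℝ) {η : ℝ → M} (J J' : S.OrthEndo η) : S.OrthEndo η :=
  fun t => Real.exp (2 * (1 - ε) / n * weightAlong (n := n) ψ η t) • S.endoB J J' t
    - (weightStar ψ ε η t / n) • (1 : Module.End ℝ (S.orth (velocity (n := n) η t)))

/-- The `ε`-expansion scalar `θ_ε = trace B_ε`. -/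
def expansion (ψ : TM n M → ℝ) (ε : ℝ) {η : ℝ → M} (J J' : S.OrthEndo η) (t : ℝ) : ℝ :=
  LinearMap.trace ℝ (S.orth (velocity (n := n) η t)) (S.endoBEps ψ ε J J' t)

/-- `τ` is an `ε`-proper time along `η` on `(a, b)`: a primitive of `e^{2(ε-1)ψ_η/n}`. -/
def IsEpsProperTime (ψ : TM n M → ℝ) (ε : ℝ) (η : ℝ → M) (a b : EReal) (τ : ℝ → ℝ) : Prop :=
  ∀ t ∈ interval a b,
    HasDerivAt τ (Real.exp (2 * (ε - 1) / n * weightAlong (n := n) ψ η t)) t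

end FinslerSpacetime

end Manifold

/-! ### The `ε`-range -/

/-- The admissible range of `ε`: `ε = 0` for `N = 0`, and `|ε| < √(N/(N-n))` for `N ≠ 0`, where the
right-hand side is `1` for `N = ∞` and `+∞` (no condition) for `N = n`. -/
def EpsRange (n : ℕ) (N : WithTop ℝ) (ε : ℝ) : Prop :=
  match N with
  | ⊤ => |ε| < 1
  | (N : ℝ) => if N = 0 then ε = 0 else if N = n then True else |ε| < Real.sqrt (N / (N - n))

/-- The constant `c(N, ε) = (1/n)(1 - ε² (N-n)/N)`, with `c(∞, ε) = (1 - ε²)/n` and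
`c(0, 0) = 1/n`. -/
def cConst (n : ℕ) (N : WithTop ℝ) (ε : ℝ) : ℝ :=
  match N with
  | ⊤ => 1 / n * (1 - ε ^ 2)
  | (N : ℝ) => if N = 0 then 1 / n else 1 / n * (1 - ε ^ 2 * ((N - n) / N))

end LorentzFinsler

end

open LorentzFinsler LorentzFinsler.FinslerSpacetime

/-!
# Zeros of Lagrange tensor fields under a weighted Ricci bound

Suppose that `J` is invertible on the closed interval between `t₀` and `t₀ + s₀`. There
`B = J' J⁻¹` satisfies the Riccati equation `B' = -R - B²`, and the Lagrange condition makes `B`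
symmetric for `g_η̇`, which is positive definite on `N_η`. Taking traces gives Raychaudhuri's
equation `θ' = -Ric(η̇) - trace B²` with `trace B² ≥ θ² / n`. For
`θ_ε = e^{2(1-ε)ψ_η/n} (θ - ψ_η')` and `Ric_N ≥ 0`, completing a square
(`weighted_quadratic_le`) turns this into `θ_ε^* ≤ -c θ_ε²` in the `ε`-proper time
(`exists_hasDerivWithinAt_expansion`). So `1/θ_ε - c τ` is non-decreasing, and `θ_ε` would have to
blow up within the `τ`-distance `1 / (c |θ_ε(t₀)|)` (`riccati_forward`, `riccati_backward`); the
assumed invertibility on the whole interval is contradictory.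

The trace of the Riccati equation (`IsJacobiTensor.hasDerivWithinAt_trace_endoB`) is obtained at
each time `t` in the chart around `η(t)`, the chart in which `R` and `g` at `η(t)` are defined, so
no invariance of these tensors under coordinate changes is used. The matrix of `J(s)`, extended
by zero on `η̇(s)`, is completed to an invertible matrix by the rank-one term `η̇(s) ⊗ ℓ`, where `ℓ`
is the covector `g(η̇, ·) / g(η̇, η̇)` at the fixed time `t`; then `trace B(s)` is the trace of
`J'(s)` times the inverse of this matrix. All contributions of the connection and of the variation
of `η̇(s)` to the derivative at `t` cancel (`hasDerivAt_trace_riccati`), so neither metric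
compatibility nor parallelism of `N_η` is needed.

The trace of `R_v` over `v^⊥` is `Ric(v)` because `R_v(v) = 0`, a consequence of Euler's identities
for the spray coefficients (`curvMat_mulVec_fibre`). The hypothesis concerns `Ric_N(η^*)`, with `η^*`
a positive multiple of `η̇`; it is evaluated along an affine reparametrization of `η`
(`isWeightedRicci_smul_velocity`).
-/

namespace LorentzFinsler

open scoped Matrix

/-! ### The scalar Riccati inequality -/

/-- Along a solution of `f' ≤ -c τ' f²`, the derivative of `1/f - c τ` is `-f'/f² - c τ' ≥ 0`. -/
theorem monotoneOn_inv_sub_of_riccati {f f' τ τ' : ℝ → ℝ} {c p q : ℝ}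
    (hf : ∀ t ∈ Icc p q, HasDerivWithinAt f (f' t) (Icc p q) t)
    (hτ : ∀ t ∈ Icc p q, HasDerivWithinAt τ (τ' t) (Icc p q) t)
    (h : ∀ t ∈ Icc p q, f' t ≤ -(c * τ' t * f t ^ 2)) (h0 : ∀ t ∈ Icc p q, f t ≠ 0) :
    MonotoneOn (fun t => (f t)⁻¹ - c * τ t) (Icc p q) := by
  have hd : ∀ t ∈ Icc p q, HasDerivWithinAt (fun t => (f t)⁻¹ - c * τ t)
      (-f' t / f t ^ 2 - c * τ' t) (Icc p q) t := fun t ht =>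
    ((hf t ht).inv (h0 t ht)).sub ((hτ t ht).const_mul c)
  refine monotoneOn_of_hasDerivWithinAt_nonneg (convex_Icc p q)
    (fun t ht => (hd t ht).continuousWithinAt)
    (fun t ht => (hd t (interior_subset ht)).mono interior_subset) fun t ht => ?_
  have ht := interior_subset ht
  have h2 : 0 < f t ^ 2 := by have := h0 t ht; positivity
  rw [sub_nonneg, le_div_iff₀ h2]
  linarith [h t ht]

theorem antitoneOn_of_riccati {f f' τ' : ℝ → ℝ} {c p q : ℝ} (hc : 0 ≤ c)
    (hf : ∀ t ∈ Icc p q, HasDerivWithinAt f (f' t) (Icc p q) t)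
    (hτ' : ∀ t ∈ Icc p q, 0 ≤ τ' t)
    (h : ∀ t ∈ Icc p q, f' t ≤ -(c * τ' t * f t ^ 2)) : AntitoneOn f (Icc p q) := by
  refine antitoneOn_of_hasDerivWithinAt_nonpos (convex_Icc p q)
    (fun t ht => (hf t ht).continuousWithinAt)
    (fun t ht => (hf t (interior_subset ht)).mono interior_subset) fun t ht => ?_
  have ht := interior_subset ht
  have := mul_nonneg (mul_nonneg hc (hτ' t ht)) (sq_nonneg (f t))
  linarith [h t ht]

/-- A solution of `f' ≤ -c τ' f²` that is negative at `p` satisfies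
`c (τ q - τ p) < -1 / f p` as long as it exists on `[p, q]`. -/
theorem riccati_forward {f f' τ τ' : ℝ → ℝ} {c p q : ℝ} (hc : 0 ≤ c) (hpq : p ≤ q)
    (hf : ∀ t ∈ Icc p q, HasDerivWithinAt f (f' t) (Icc p q) t)
    (hτ : ∀ t ∈ Icc p q, HasDerivWithinAt τ (τ' t) (Icc p q) t)
    (hτ' : ∀ t ∈ Icc p q, 0 ≤ τ' t)
    (h : ∀ t ∈ Icc p q, f' t ≤ -(c * τ' t * f t ^ 2)) (hneg : f p < 0) :
    c * (τ q - τ p) < -(f p)⁻¹ := by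
  have hp := left_mem_Icc.2 hpq
  have hq := right_mem_Icc.2 hpq
  have hlt : ∀ t ∈ Icc p q, f t < 0 := fun t ht =>
    (antitoneOn_of_riccati hc hf hτ' h hp ht ht.1).trans_lt hneg
  have := monotoneOn_inv_sub_of_riccati hf hτ h (fun t ht => (hlt t ht).ne) hp hq hpq
  have h3 := inv_lt_zero.2 (hlt q hq)
  simp only at this
  linarith

/-- A solution of `f' ≤ -c τ' f²` that is positive at `q` satisfies
`c (τ q - τ p) < 1 / f q` as long as it exists on `[p, q]`. -/
theorem riccati_backward {f f' τ τ' : ℝ → ℝ} {c p q : ℝ} (hc : 0 ≤ c) (hpq : p ≤ q)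
    (hf : ∀ t ∈ Icc p q, HasDerivWithinAt f (f' t) (Icc p q) t)
    (hτ : ∀ t ∈ Icc p q, HasDerivWithinAt τ (τ' t) (Icc p q) t)
    (hτ' : ∀ t ∈ Icc p q, 0 ≤ τ' t)
    (h : ∀ t ∈ Icc p q, f' t ≤ -(c * τ' t * f t ^ 2)) (hpos : 0 < f q) :
    c * (τ q - τ p) < (f q)⁻¹ := by
  have hp := left_mem_Icc.2 hpq
  have hq := right_mem_Icc.2 hpq
  have hlt : ∀ t ∈ Icc p q, 0 < f t := fun t ht =>
    hpos.trans_le (antitoneOn_of_riccati hc hf hτ' h ht hq ht.2)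
  have := monotoneOn_inv_sub_of_riccati hf hτ h (fun t ht => (hlt t ht).ne') hp hq hpq
  have h3 := inv_pos.2 (hlt p hp)
  simp only at this
  linarith

/-! ### Linear algebra of a Lorentzian form -/

/-- The reverse Cauchy–Schwarz principle: a form of signature `(-, +, …, +)` is positive on the
orthogonal complement of a timelike vector. -/
theorem lorentz_pos_of_orthogonal {n : ℕ} {V : Type*} [AddCommGroup V] [Module ℝ V]
    (g : V →ₗ[ℝ] V →ₗ[ℝ] ℝ) (b : Module.Basis (Fin (n + 1)) ℝ V)
    (hb : ∀ i j, g (b i) (b j) = if i = j then (if i = 0 then -1 else 1) else 0)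
    {v w : V} (hv : g v v < 0) (hvw : g v w = 0) (hw : w ≠ 0) : 0 < g w w := by
  have key : ∀ x y : V, g x y = -(b.repr x 0 * b.repr y 0) +
      ∑ i : Fin n, b.repr x i.succ * b.repr y i.succ := by
    intro x y
    conv_lhs => rw [← b.sum_repr x, ← b.sum_repr y]
    simp only [map_sum, map_smul, LinearMap.sum_apply, LinearMap.smul_apply, hb, smul_eq_mul]
    simp [Fin.sum_univ_succ, Fin.succ_ne_zero, mul_comm]
  rw [key] at hv hvw
  rw [key]
  set x : Fin n → ℝ := fun i => b.repr v i.succ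
  set y : Fin n → ℝ := fun i => b.repr w i.succ
  have hCS : (∑ i, x i * y i) ^ 2 ≤ (∑ i, x i ^ 2) * ∑ i, y i ^ 2 :=
    Finset.sum_mul_sq_le_sq_mul_sq _ _ _
  have hX : ∑ i : Fin n, b.repr v i.succ * b.repr v i.succ = ∑ i, x i ^ 2 := by simp [x, sq]
  have hY : ∑ i : Fin n, b.repr w i.succ * b.repr w i.succ = ∑ i, y i ^ 2 := by simp [y, sq]
  have hXY : ∑ i : Fin n, b.repr v i.succ * b.repr w i.succ = ∑ i, x i * y i := rfl
  rw [hX] at hv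
  rw [hXY] at hvw
  rw [hY]
  set a := b.repr v 0
  set d := b.repr w 0
  have hX0 : 0 ≤ ∑ i, x i ^ 2 := Finset.sum_nonneg fun i _ => sq_nonneg _
  have hY0 : 0 ≤ ∑ i, y i ^ 2 := Finset.sum_nonneg fun i _ => sq_nonneg _
  have had : ∑ i, x i * y i = a * d := by linarith
  rw [had] at hCS
  have ha : 0 < a * a := by linarith
  rcases hY0.lt_or_eq with hpos | hzero
  · by_contra hcon
    have h1 : ∑ i, y i ^ 2 ≤ d * d := by linarith
    have : (∑ i, x i ^ 2) * ∑ i, y i ^ 2 < a * a * ∑ i, y i ^ 2 := by nlinarith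
    nlinarith
  · rw [← hzero, mul_zero] at hCS
    have hd : d = 0 := by
      have : (a * d) ^ 2 = 0 := le_antisymm hCS (sq_nonneg _)
      have := pow_eq_zero_iff (two_ne_zero) |>.1 this
      rcases mul_eq_zero.1 this with h | h
      · simp [h] at ha
      · exact h
    refine absurd (b.repr.map_eq_zero_iff.1 (Finsupp.ext fun i => ?_)) hw
    refine Fin.cases hd (fun i => ?_) i
    have := (Finset.sum_eq_zero_iff_of_nonneg fun i _ => sq_nonneg (y i)).1 hzero.symm i
      (Finset.mem_univ i)
    simpa using this

/-- The square of an endomorphism that is symmetric for a positive definite form has non-negative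
trace: in an orthogonal basis `(e_i)` it is `∑ g(A e_i, A e_i) / g(e_i, e_i)`. -/
theorem trace_sq_nonneg_of_symmetric {V : Type*} [AddCommGroup V] [Module ℝ V]
    [FiniteDimensional ℝ V] (g : V →ₗ[ℝ] V →ₗ[ℝ] ℝ) (hs : ∀ x y, g x y = g y x)
    (hp : ∀ x, x ≠ 0 → 0 < g x x) (A : Module.End ℝ V) (hA : ∀ x y, g (A x) y = g x (A y)) :
    0 ≤ LinearMap.trace ℝ V (A * A) := by
  obtain ⟨e, he⟩ := LinearMap.BilinForm.exists_orthogonal_basis (B := g)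
    ⟨hs⟩
  rw [LinearMap.trace_eq_matrix_trace ℝ e, Matrix.trace]
  have hpe : ∀ i, 0 < g (e i) (e i) := fun i => hp _ (e.ne_zero i)
  refine Finset.sum_nonneg fun i _ => ?_
  have hrepr : ∀ w, g (e i) w = e.repr w i * g (e i) (e i) := by
    intro w
    conv_lhs => rw [← e.sum_repr w]
    rw [map_sum, Finset.sum_eq_single i]
    · simp
    · intro j _ hj
      have : g (e i) (e j) = 0 := he hj.symm
      simp [this]
    · simp
  rw [Matrix.diag_apply, LinearMap.toMatrix_apply]
  have h1 : 0 ≤ e.repr ((A * A) (e i)) i * g (e i) (e i) := by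
    rw [← hrepr, Module.End.mul_apply, ← hA]
    by_cases h : A (e i) = 0
    · simp [h]
    · exact (hp _ h).le
  exact nonneg_of_mul_nonneg_left h1 (hpe i)

/-- Cauchy–Schwarz for the trace of a symmetric endomorphism. -/
theorem sq_trace_le_of_symmetric {V : Type*} [AddCommGroup V] [Module ℝ V]
    [FiniteDimensional ℝ V] (g : V →ₗ[ℝ] V →ₗ[ℝ] ℝ) (hs : ∀ x y, g x y = g y x)
    (hp : ∀ x, x ≠ 0 → 0 < g x x) (A : Module.End ℝ V) (hA : ∀ x y, g (A x) y = g x (A y))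
    {n : ℕ} (hn : 1 ≤ n) (hV : Module.finrank ℝ V = n) :
    LinearMap.trace ℝ V A ^ 2 / n ≤ LinearMap.trace ℝ V (A * A) := by
  have hn' : (0 : ℝ) < n := by exact_mod_cast hn
  set c : ℝ := LinearMap.trace ℝ V A / n with hc
  have h := trace_sq_nonneg_of_symmetric g hs hp (A - c • 1) (by simp [hA])
  have h2 : (A - c • 1) * (A - c • 1) = A * A - (2 * c) • A + (c * c) • (1 : Module.End ℝ V) := by
    simp only [sub_mul, mul_sub, smul_mul_assoc, mul_smul_comm, one_mul, mul_one]
    module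
  rw [h2, map_add, map_sub, map_smul, map_smul, LinearMap.trace_one, hV] at h
  simp only [smul_eq_mul] at h
  have : LinearMap.trace ℝ V A ^ 2 / n = 2 * c * LinearMap.trace ℝ V A - c * c * n := by
    rw [hc]; field_simp; ring
  linarith

/-! ### The derivative of a trace along a matrix Riccati equation -/

theorem hasDerivAt_trace_mul_inv {ι : Type*} [Fintype ι] [DecidableEq ι]
    {A M : ℝ → Matrix ι ι ℝ} {A' M' : Matrix ι ι ℝ} {t : ℝ}
    (hA : ∀ i j, HasDerivAt (fun s => A s i j) (A' i j) t)
    (hM : ∀ i j, HasDerivAt (fun s => M s i j) (M' i j) t) (hu : IsUnit (M t)) :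
    HasDerivAt (fun s => (A s * (M s)⁻¹).trace)
      ((A' * (M t)⁻¹).trace - (A t * (M t)⁻¹ * M' * (M t)⁻¹).trace) t := by
  let _ : NormedRing (Matrix ι ι ℝ) := Matrix.linftyOpNormedRing
  let _ : NormedAlgebra ℝ (Matrix ι ι ℝ) := Matrix.linftyOpNormedAlgebra
  have h1 : HasDerivAt A A' t := hasDerivAt_pi.2 fun i => hasDerivAt_pi.2 fun j => hA i j
  have h2 : HasDerivAt M M' t := hasDerivAt_pi.2 fun i => hasDerivAt_pi.2 fun j => hM i j
  obtain ⟨u, hu⟩ := hu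
  have h3 := (hu ▸ hasFDerivAt_ringInverse (𝕜 := ℝ) u).comp_hasDerivAt t h2
  have h4 := h1.mul h3
  have h5 : HasDerivAt (fun s => (A s * (M s)⁻¹).trace) (Matrix.trace
      (A' * (Ring.inverse ∘ M) t +
        A t * (-ContinuousLinearMap.mulLeftRight ℝ (Matrix ι ι ℝ) ↑u⁻¹ ↑u⁻¹) M')) t := by
    have h6 := HasDerivAt.fun_sum (u := Finset.univ) fun i (_ : i ∈ Finset.univ) =>
      hasDerivAt_pi.1 (hasDerivAt_pi.1 h4 i) i
    simp only [Matrix.nonsing_inv_eq_ringInverse]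
    exact h6
  convert h5 using 1
  have h7 : (M t)⁻¹ = ↑u⁻¹ := by rw [← hu, Matrix.coe_units_inv]
  simp only [Function.comp_apply, ← Matrix.nonsing_inv_eq_ringInverse, h7, Matrix.trace_add,
    neg_apply, ContinuousLinearMap.mulLeftRight_apply, mul_neg,
    Matrix.trace_neg, mul_assoc, sub_eq_add_neg]

/-- Let `J' = A` and `A' = A₂` up to the commutator with a connection matrix `Ω`, and let `K`
invert `J` on the kernel of `ℓ`, where `v` is a transversal vector annihilated by `J`, `A`
and `A₂`. Completing `J` to an invertible matrix with the rank-one term `v ⊗ ℓ`, in which `ℓ` is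
frozen at time `t`, gives the trace of the Riccati equation `B' = A₂ K - B²` for `B = A K`; neither
the connection nor the variation of `v` enters. -/
theorem hasDerivAt_trace_riccati {ι : Type*} [Fintype ι] [DecidableEq ι]
    {A J : ℝ → Matrix ι ι ℝ} {v : ℝ → ι → ℝ} {v' ℓ : ι → ℝ} {A₂ K Ω : Matrix ι ι ℝ} {t : ℝ}
    (hJ : ∀ i j, HasDerivAt (fun s => J s i j) ((A t - Ω * J t + J t * Ω) i j) t)
    (hA : ∀ i j, HasDerivAt (fun s => A s i j) ((A₂ - Ω * A t + A t * Ω) i j) t)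
    (hv : ∀ i, HasDerivAt (fun s => v s i) (v' i) t)
    (hℓv : ℓ ⬝ᵥ v t = 1) (hJv : J t *ᵥ v t = 0) (hAv : A t *ᵥ v t = 0) (hA₂v : A₂ *ᵥ v t = 0)
    (hℓA : ℓ ᵥ* A t = 0) (hℓK : ℓ ᵥ* K = 0)
    (hJK : J t * K = 1 - Matrix.vecMulVec (v t) ℓ)
    (hKJ : K * J t = 1 - Matrix.vecMulVec (v t) ℓ) :
    (∀ᶠ s in 𝓝 t, IsUnit (J s + Matrix.vecMulVec (v s) ℓ)) ∧
    HasDerivAt (fun s => (A s * (J s + Matrix.vecMulVec (v s) ℓ)⁻¹).trace)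
      ((A₂ * K).trace - (A t * K * (A t * K)).trace) t := by
  set V := Matrix.vecMulVec (v t) ℓ with hV
  set W := Matrix.vecMulVec v' ℓ with hW
  have hJV : J t * V = 0 := by rw [hV, Matrix.mul_vecMulVec, hJv, Matrix.zero_vecMulVec]
  have hAV : A t * V = 0 := by rw [hV, Matrix.mul_vecMulVec, hAv, Matrix.zero_vecMulVec]
  have hA₂V : A₂ * V = 0 := by rw [hV, Matrix.mul_vecMulVec, hA₂v, Matrix.zero_vecMulVec]
  have hVA : V * A t = 0 := by rw [hV, Matrix.vecMulVec_mul, hℓA, Matrix.vecMulVec_zero]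
  have hWA : W * A t = 0 := by rw [hW, Matrix.vecMulVec_mul, hℓA, Matrix.vecMulVec_zero]
  have hVK : V * K = 0 := by rw [hV, Matrix.vecMulVec_mul, hℓK, Matrix.vecMulVec_zero]
  have hWK : W * K = 0 := by rw [hW, Matrix.vecMulVec_mul, hℓK, Matrix.vecMulVec_zero]
  have hVV : V * V = V := by
    rw [hV, Matrix.vecMulVec_mul_vecMulVec, hℓv, one_smul]
  have hWV : W * V = W := by
    rw [hV, hW, Matrix.vecMulVec_mul_vecMulVec, hℓv, one_smul]
  -- At time `t` the completed matrix has the explicit inverse `K + V`.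
  have hMK : (J t + V) * (K + V) = 1 := by
    rw [add_mul, mul_add, mul_add, hJK, hJV, hVK, hVV]; abel
  have hinv : (J t + V)⁻¹ = K + V := Matrix.inv_eq_right_inv hMK
  have hu : IsUnit (J t + V) := IsUnit.of_mul_eq_one _ hMK
  have hM : ∀ i j, HasDerivAt (fun s => (J s + Matrix.vecMulVec (v s) ℓ) i j)
      ((A t - Ω * J t + J t * Ω + W) i j) t := fun i j => by
    exact (hJ i j).add ((hv i).mul_const (ℓ j))
  refine ⟨?_, ?_⟩
  · have hc : ContinuousAt (fun s => J s + Matrix.vecMulVec (v s) ℓ) t :=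
      continuousAt_pi.2 fun i => continuousAt_pi.2 fun j => (hM i j).continuousAt
    have hdet := (continuous_id.matrix_det (R := ℝ)).continuousAt.comp hc
    filter_upwards [hdet.eventually_ne ((Matrix.isUnit_iff_isUnit_det _).1 hu).ne_zero] with s hs
    exact (Matrix.isUnit_iff_isUnit_det _).2 (isUnit_iff_ne_zero.2 hs)
  convert hasDerivAt_trace_mul_inv hA hM hu using 1
  rw [← hV, hinv]
  have e1 : (A₂ - Ω * A t + A t * Ω) * (K + V) =
      A₂ * K - Ω * (A t * K) + A t * Ω * (K + V) := by
    have : Ω * A t * V = 0 := by rw [mul_assoc, hAV, mul_zero]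
    rw [add_mul, sub_mul, mul_add, mul_add (Ω * A t), hA₂V, this, mul_assoc Ω, add_zero, add_zero]
  have e2 : A t * (K + V) = A t * K := by rw [mul_add, hAV, add_zero]
  have e3 : A t * K * J t = A t := by rw [mul_assoc, hKJ, mul_sub, hAV, mul_one, sub_zero]
  have e4 : J t * (K + V) = 1 - V := by rw [mul_add, hJK, hJV, add_zero]
  have e5 : W * (K + V) = W := by rw [mul_add, hWK, hWV, zero_add]
  have e6 : A t * (K + V) * (A t - Ω * J t + J t * Ω + W) * (K + V) =
      A t * K * (A t * K) - A t * K * Ω + A t * K * Ω * V + A t * Ω * (K + V) + A t * K * W := by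
    calc _ = A t * K * (A t - Ω * J t + J t * Ω + W) * (K + V) := by rw [e2]
      _ = A t * K * (A t * (K + V)) - A t * K * Ω * (J t * (K + V)) +
          A t * K * J t * Ω * (K + V) + A t * K * (W * (K + V)) := by
          noncomm_ring
      _ = _ := by rw [e2, e3, e4, e5, mul_sub, mul_one]; abel
  have t1 : (A t * K * Ω * V).trace = 0 := by
    rw [Matrix.trace_mul_comm, ← mul_assoc, ← mul_assoc, hVA, zero_mul, zero_mul, Matrix.trace_zero]
  have t2 : (A t * K * W).trace = 0 := by
    rw [Matrix.trace_mul_comm, ← mul_assoc, hWA, zero_mul, Matrix.trace_zero]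
  have t3 : (Ω * (A t * K)).trace = (A t * K * Ω).trace := Matrix.trace_mul_comm _ _
  rw [e1, e6]
  simp only [Matrix.trace_add, Matrix.trace_sub, t1, t2, t3]
  ring

/-! ### Homogeneity of the coordinate expressions -/

section Homogeneity

variable {n : ℕ}

/-- `f` is positively homogeneous of degree `k` in the fibre variable. -/
def FibreHomogeneous (k : ℕ) (f : Model n × Model n → ℝ) : Prop :=
  ∀ c : ℝ, 0 < c → ∀ x v, f (x, c • v) = c ^ k * f (x, v)

theorem fderiv_fibre_scale {k : ℕ} {f : Model n × Model n → ℝ} (hf : FibreHomogeneous k f) {c : ℝ}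
    (hc : 0 < c) (x v y w : Model n) :
    fderiv ℝ f (x, c • v) (y, c • w) = c ^ k * fderiv ℝ f (x, v) (y, w) := by
  let e : (Model n × Model n) ≃L[ℝ] (Model n × Model n) :=
    (ContinuousLinearEquiv.refl ℝ (Model n)).prodCongr
      (ContinuousLinearEquiv.smulLeft (Units.mk0 c hc.ne'))
  have he : ∀ x v, e (x, v) = (x, c • v) := fun _ _ => rfl
  have h1 : f ∘ e = c ^ k • f := funext fun q => hf c hc q.1 q.2
  have h2 := e.comp_right_fderiv (f := f) (x := (x, v))
  rw [h1, fderiv_const_smul_field] at h2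
  have h3 := congrArg (fun T => T (y, w)) h2
  simpa [he] using h3.symm

theorem FibreHomogeneous.pdx {k : ℕ} {f : Model n × Model n → ℝ} (hf : FibreHomogeneous k f)
    (α : Fin (n + 1)) : FibreHomogeneous k (pdx α f) := fun c hc x v => by
  simpa [LorentzFinsler.pdx] using fderiv_fibre_scale hf hc x v (EuclideanSpace.single α 1) 0

theorem FibreHomogeneous.pdv {k : ℕ} {f : Model n × Model n → ℝ}
    (hf : FibreHomogeneous (k + 1) f) (α : Fin (n + 1)) : FibreHomogeneous k (pdv α f) :=
  fun c hc x v => by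
  have h := fderiv_fibre_scale hf hc x v 0 (EuclideanSpace.single α 1)
  have e : ((0 : Model n), c • EuclideanSpace.single α (1 : ℝ)) =
    c • ((0 : Model n), EuclideanSpace.single α (1 : ℝ)) := by simp
  rw [e, map_smul, smul_eq_mul, pow_succ, mul_assoc, mul_left_comm] at h
  exact mul_left_cancel₀ hc.ne' h

theorem eq_sum_single (w : Model n) : w = ∑ α, w α • EuclideanSpace.single α (1 : ℝ) := by
  have := (EuclideanSpace.basisFun (Fin (n + 1)) ℝ).sum_repr w
  simpa using this.symm

theorem fderiv_apply_fibre (f : Model n × Model n → ℝ) (p : Model n × Model n) (w : Model n) :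
    fderiv ℝ f p (0, w) = ∑ α, w α * pdv α f p := by
  have h : ((0 : Model n), w) = ∑ α, w α • ((0 : Model n), EuclideanSpace.single α (1 : ℝ)) := by
    conv_lhs => rw [eq_sum_single w]
    ext1 <;> simp [Prod.fst_sum, Prod.snd_sum]
  rw [h, map_sum]
  exact Finset.sum_congr rfl fun α _ => map_smul _ _ _

/-- Euler's identity `v^α ∂f/∂v^α = k f`. -/
theorem FibreHomogeneous.euler {k : ℕ} {f : Model n × Model n → ℝ} (hf : FibreHomogeneous k f)
    {p : Model n × Model n} (hd : DifferentiableAt ℝ f p) :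
    ∑ α, p.2 α * LorentzFinsler.pdv α f p = k * f p := by
  rw [← fderiv_apply_fibre]
  have h1 : HasDerivAt (fun c : ℝ => (p.1, c • p.2)) ((0 : Model n), p.2) 1 := by
    simpa using (hasDerivAt_const (1 : ℝ) p.1).prodMk ((hasDerivAt_id (1 : ℝ)).smul_const p.2)
  have h2 : HasDerivAt (fun c : ℝ => f (p.1, c • p.2)) (fderiv ℝ f p (0, p.2)) 1 := by
    have hd' : HasFDerivAt f (fderiv ℝ f p) (p.1, (1 : ℝ) • p.2) := by
      simpa using hd.hasFDerivAt
    exact hd'.comp_hasDerivAt (1 : ℝ) h1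
  have h3 : HasDerivAt (fun c : ℝ => c ^ k * f p) (k * f p) 1 := by
    simpa using (hasDerivAt_pow k (1 : ℝ)).mul_const (f p)
  refine h2.unique (h3.congr_of_eventuallyEq ?_)
  filter_upwards [lt_mem_nhds (zero_lt_one (α := ℝ))] with c hc
  exact hf c hc p.1 p.2

variable {Λ : Model n × Model n → ℝ}

theorem fibreHomogeneous_gMat (hΛ : FibreHomogeneous 2 Λ) (α β : Fin (n + 1)) :
    FibreHomogeneous 0 (fun q => gMat Λ q α β) :=
  (FibreHomogeneous.pdv (k := 1) hΛ β).pdv α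

theorem gMat_scale (hΛ : FibreHomogeneous 2 Λ) {c : ℝ} (hc : 0 < c) (x v : Model n) :
    gMat Λ (x, c • v) = gMat Λ (x, v) := by
  ext α β
  simpa using fibreHomogeneous_gMat hΛ α β c hc x v

theorem fibreHomogeneous_christoffelTilde (hΛ : FibreHomogeneous 2 Λ) (α β γ : Fin (n + 1)) :
    FibreHomogeneous 0 (christoffelTilde Λ α β γ) := fun c hc x v => by
  have h := fun α β γ : Fin (n + 1) => (fibreHomogeneous_gMat hΛ α β).pdx γ c hc x v
  simp only [pow_zero, one_mul] at h
  simp only [christoffelTilde, gInv, gMat_scale hΛ hc, h, pow_zero, one_mul]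

theorem fibreHomogeneous_spray (hΛ : FibreHomogeneous 2 Λ) (α : Fin (n + 1)) :
    FibreHomogeneous 2 (spray Λ α) := fun c hc x v => by
  have h := fun β γ : Fin (n + 1) => fibreHomogeneous_christoffelTilde hΛ α β γ c hc x v
  simp only [pow_zero, one_mul] at h
  simp only [spray, h, Finset.mul_sum, PiLp.smul_apply, smul_eq_mul]
  exact Finset.sum_congr rfl fun β _ => Finset.sum_congr rfl fun γ _ => by ring

theorem fibreHomogeneous_nonlinConn (hΛ : FibreHomogeneous 2 Λ) (α β : Fin (n + 1)) :
    FibreHomogeneous 1 (nonlinConn Λ α β) :=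
  (fibreHomogeneous_spray hΛ α).pdv β

theorem curvMat_scale (hΛ : FibreHomogeneous 2 Λ) {c : ℝ} (hc : 0 < c) (x v : Model n) :
    curvMat Λ (x, c • v) = c ^ 2 • curvMat Λ (x, v) := by
  ext α β
  have h1 := (fibreHomogeneous_spray hΛ α).pdx β c hc x v
  have h2 := fun γ => fibreHomogeneous_spray hΛ γ c hc x v
  have h3 := fun α β => fibreHomogeneous_nonlinConn hΛ α β c hc x v
  have h4 := fun γ => (fibreHomogeneous_nonlinConn hΛ α β).pdx γ c hc x v
  have h5 := fun γ => (FibreHomogeneous.pdv (k := 0) (fibreHomogeneous_nonlinConn hΛ α β)) γ c hc x v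
  simp only [pow_zero, one_mul, pow_one] at h3 h4 h5
  simp only [curvMat, Matrix.of_apply, Matrix.smul_apply, smul_eq_mul, h1, h2, h3, h4, h5,
    PiLp.smul_apply, mul_sub, Finset.mul_sum]
  congr 1
  · congr 1
    · ring
    · exact Finset.sum_congr rfl fun γ _ => by ring
  · exact Finset.sum_congr rfl fun γ _ => by ring

/-! ### Regularity, and the kernel of the curvature endomorphism -/

theorem contDiffAt_pdx {f : Model n × Model n → ℝ} {p : Model n × Model n}
    (hf : ContDiffAt ℝ ∞ f p) (α : Fin (n + 1)) : ContDiffAt ℝ ∞ (pdx α f) p :=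
  (hf.fderiv_right (m := ∞) (by simp)).clm_apply contDiffAt_const

theorem contDiffAt_pdv {f : Model n × Model n → ℝ} {p : Model n × Model n}
    (hf : ContDiffAt ℝ ∞ f p) (α : Fin (n + 1)) : ContDiffAt ℝ ∞ (pdv α f) p :=
  (hf.fderiv_right (m := ∞) (by simp)).clm_apply contDiffAt_const

theorem contDiffAt_gMat {p : Model n × Model n} (hΛ : ContDiffAt ℝ ∞ Λ p) (α β : Fin (n + 1)) :
    ContDiffAt ℝ ∞ (fun q => gMat Λ q α β) p :=
  contDiffAt_pdv (contDiffAt_pdv hΛ β) α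

theorem contDiffAt_det {ι : Type*} [Fintype ι] [DecidableEq ι] {E : Type*} [NormedAddCommGroup E]
    [NormedSpace ℝ E] {F : E → Matrix ι ι ℝ} {p : E}
    (hF : ∀ i j, ContDiffAt ℝ ∞ (fun q => F q i j) p) :
    ContDiffAt ℝ ∞ (fun q => (F q).det) p := by
  simp only [Matrix.det_apply]
  exact ContDiffAt.sum fun σ _ => (contDiffAt_prod fun i _ => hF _ _).const_smul _

/-- Cramer's rule makes `g^{αβ}` smooth wherever `g` is non-degenerate. -/
theorem contDiffAt_gInv {p : Model n × Model n} (hΛ : ContDiffAt ℝ ∞ Λ p)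
    (hdet : (gMat Λ p).det ≠ 0) (α β : Fin (n + 1)) :
    ContDiffAt ℝ ∞ (fun q => gInv Λ q α β) p := by
  simp only [gInv, Matrix.inv_def, Matrix.smul_apply, Ring.inverse_eq_inv', smul_eq_mul,
    Matrix.adjugate_apply]
  refine ((contDiffAt_det fun i j => contDiffAt_gMat hΛ i j).inv hdet).mul
    (contDiffAt_det fun i j => ?_)
  by_cases h : i = β
  · simp only [Matrix.updateRow_apply, h, if_true]
    exact contDiffAt_const
  · simp only [Matrix.updateRow_apply, h, if_false]
    exact contDiffAt_gMat hΛ i j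

theorem contDiffAt_fibre_apply (p : Model n × Model n) (α : Fin (n + 1)) :
    ContDiffAt ℝ ∞ (fun q : Model n × Model n => q.2 α) p :=
  ((EuclideanSpace.proj (𝕜 := ℝ) α : Model n →L[ℝ] ℝ).contDiff.comp contDiff_snd).contDiffAt

theorem contDiffAt_spray {p : Model n × Model n} (hΛ : ContDiffAt ℝ ∞ Λ p)
    (hdet : (gMat Λ p).det ≠ 0) (α : Fin (n + 1)) : ContDiffAt ℝ ∞ (spray Λ α) p := by
  have hg := fun α β γ => contDiffAt_pdx (contDiffAt_gMat hΛ α β) γ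
  refine contDiffAt_const.mul (ContDiffAt.sum fun β _ => ContDiffAt.sum fun γ _ => ?_)
  refine ((ContDiffAt.mul ?_ (contDiffAt_fibre_apply p β)).mul (contDiffAt_fibre_apply p γ))
  exact contDiffAt_const.mul (ContDiffAt.sum fun δ _ => (contDiffAt_gInv hΛ hdet α δ).mul
    (((hg δ γ β).add (hg β δ γ)).sub (hg β γ δ)))

/-- `g_{αβ}(v) v^α v^β = 2 L(v)`. -/
theorem gMat_fibre_fibre {p : Model n × Model n} (hΛ : ContDiffAt ℝ ∞ Λ p)
    (hh : FibreHomogeneous 2 Λ) : ∑ α, ∑ β, p.2 α * p.2 β * gMat Λ p α β = 2 * Λ p := by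
  have h1 := hh.euler (hΛ.differentiableAt (by simp))
  have h2 := fun β => (FibreHomogeneous.pdv (k := 1) hh β).euler
    ((contDiffAt_pdv hΛ β).differentiableAt (by simp))
  rw [Finset.sum_comm]
  push_cast at h1 h2
  rw [← h1]
  refine Finset.sum_congr rfl fun β _ => ?_
  rw [← one_mul (LorentzFinsler.pdv β Λ p), ← h2 β, Finset.mul_sum]
  exact Finset.sum_congr rfl fun α _ => by simp only [gMat, Matrix.of_apply]; ring

theorem fderiv_sum_fibre_mul {f : Fin (n + 1) → Model n × Model n → ℝ} {p : Model n × Model n}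
    (hf : ∀ β, DifferentiableAt ℝ (f β) p) (y w : Model n) :
    fderiv ℝ (fun q => ∑ β, q.2 β * f β q) p (y, w) =
      ∑ β, (p.2 β * fderiv ℝ (f β) p (y, w) + w β * f β p) := by
  have h : ∀ β, HasFDerivAt (fun q : Model n × Model n => q.2 β)
      ((EuclideanSpace.proj β : Model n →L[ℝ] ℝ).comp (ContinuousLinearMap.snd ℝ _ _)) p :=
    fun β => ContinuousLinearMap.hasFDerivAt ((EuclideanSpace.proj β : Model n →L[ℝ] ℝ).comp
      (ContinuousLinearMap.snd ℝ (Model n) (Model n)))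
  rw [(HasFDerivAt.fun_sum fun β _ => (h β).fun_mul (hf β).hasFDerivAt).fderiv]
  simp [mul_comm]

/-- `R_v(v) = 0`: by Euler's identities `N^α_β v^β = 2 G^α` and its derivatives, the terms of
`R^α_β v^β` cancel. -/
theorem curvMat_mulVec_fibre {p : Model n × Model n} (hΛ : ContDiffAt ℝ ∞ Λ p)
    (hh : FibreHomogeneous 2 Λ) (hdet : (gMat Λ p).det ≠ 0) (α : Fin (n + 1)) :
    ∑ β, curvMat Λ p α β * p.2 β = 0 := by
  have hG : ContDiffAt ℝ ∞ (spray Λ α) p := contDiffAt_spray hΛ hdet α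
  have hN : ∀ β, DifferentiableAt ℝ (nonlinConn Λ α β) p := fun β =>
    (contDiffAt_pdv hG β).differentiableAt (by simp)
  have hev : (fun q => ∑ β, q.2 β * nonlinConn Λ α β q) =ᶠ[𝓝 p] fun q => 2 * spray Λ α q := by
    filter_upwards [(hG.of_le (m := 1) (by simp)).eventually (by simp)] with q hq
    simpa [nonlinConn] using (fibreHomogeneous_spray hh α).euler (hq.differentiableAt (by simp))
  have hd : ∀ y w, ∑ β, (p.2 β * fderiv ℝ (nonlinConn Λ α β) p (y, w) + w β * nonlinConn Λ α β p) =
      2 * fderiv ℝ (spray Λ α) p (y, w) := by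
    intro y w
    rw [← fderiv_sum_fibre_mul hN, hev.fderiv_eq, fderiv_const_mul (hG.differentiableAt (by simp))]
    simp
  have hx : ∀ γ, ∑ β, p.2 β * pdx γ (nonlinConn Λ α β) p = 2 * pdx γ (spray Λ α) p := by
    intro γ
    simpa [pdx] using hd (EuclideanSpace.single γ 1) 0
  have hv : ∀ γ, ∑ β, p.2 β * pdv γ (nonlinConn Λ α β) p = nonlinConn Λ α γ p := by
    intro γ
    have := hd 0 (EuclideanSpace.single γ 1)
    rw [Finset.sum_add_distrib] at this
    simp only [PiLp.single_apply, ite_mul, one_mul, zero_mul, Finset.sum_ite_eq',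
      Finset.mem_univ, if_true] at this
    change _ + _ = 2 * nonlinConn Λ α γ p at this
    change ∑ β, p.2 β * fderiv ℝ (nonlinConn Λ α β) p (0, EuclideanSpace.single γ 1) = _
    linarith
  have h0 : ∀ γ, ∑ β, p.2 β * nonlinConn Λ γ β p = 2 * spray Λ γ p := fun γ => by
    simpa [nonlinConn] using (fibreHomogeneous_spray hh γ).euler
      ((contDiffAt_spray hΛ hdet γ).differentiableAt (by simp))
  have s1 : ∑ β, (∑ γ, (pdx γ (nonlinConn Λ α β) p * p.2 γ
      - 2 * pdv γ (nonlinConn Λ α β) p * spray Λ γ p)) * p.2 β =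
      ∑ γ, (2 * pdx γ (spray Λ α) p * p.2 γ - 2 * nonlinConn Λ α γ p * spray Λ γ p) := by
    simp only [Finset.sum_mul]
    rw [Finset.sum_comm]
    refine Finset.sum_congr rfl fun γ _ => ?_
    rw [← hx γ, ← hv γ, Finset.sum_mul, Finset.mul_sum, Finset.sum_mul, ← Finset.sum_sub_distrib]
    exact Finset.sum_congr rfl fun β _ => by ring
  have s2 : ∑ β, (∑ γ, nonlinConn Λ α γ p * nonlinConn Λ γ β p) * p.2 β =
      ∑ γ, 2 * nonlinConn Λ α γ p * spray Λ γ p := by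
    simp only [Finset.sum_mul]
    rw [Finset.sum_comm]
    refine Finset.sum_congr rfl fun γ _ => ?_
    rw [mul_comm 2, mul_assoc, ← h0 γ, Finset.mul_sum]
    exact Finset.sum_congr rfl fun β _ => by ring
  simp only [curvMat, Matrix.of_apply, sub_mul, Finset.sum_sub_distrib] at s1 s2 ⊢
  linarith

end Homogeneity

/-! ### Geometry of a tangent space -/

section TangentSpace

variable {n : ℕ} {M : Type*} [TopologicalSpace M] [ChartedSpace (Model n) M]
  [IsManifold (𝓡 (n + 1)) ∞ M]

instance finiteDimensional_tan (x : M) : FiniteDimensional ℝ (Tan n x) :=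
  inferInstanceAs (FiniteDimensional ℝ (Model n))

theorem tanCoord_tanCoordInv {x₀ x : M} (hx : x ∈ (chartAt (Model n) x₀).source) (w : Model n) :
    tanCoord x₀ x (tanCoordInv x₀ x w) = w :=
  (trivializationAt (Model n) (TangentSpace (𝓡 (n + 1))) x₀).continuousLinearMapAt_symmL
    (show x ∈ (trivializationAt (Model n) (TangentSpace (𝓡 (n + 1))) x₀).baseSet from hx) w

theorem tanCoordInv_tanCoord {x₀ x : M} (hx : x ∈ (chartAt (Model n) x₀).source) (w : Tan n x) :
    tanCoordInv x₀ x (tanCoord x₀ x w) = w :=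
  (trivializationAt (Model n) (TangentSpace (𝓡 (n + 1))) x₀).symmL_continuousLinearMapAt
    (show x ∈ (trivializationAt (Model n) (TangentSpace (𝓡 (n + 1))) x₀).baseSet from hx) w

theorem tanCoord_ne_zero {x₀ x : M} (hx : x ∈ (chartAt (Model n) x₀).source) {w : Tan n x}
    (hw : w ≠ 0) : tanCoord x₀ x w ≠ 0 := fun h =>
  hw (by rw [← tanCoordInv_tanCoord hx w, h, map_zero])

theorem coords_smul (x₀ : M) (v : TM n M) (c : ℝ) :
    coords x₀ ⟨v.1, c • v.2⟩ = ((coords x₀ v).1, c • (coords x₀ v).2) := by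
  simp [coords]

theorem localRep_coords (L : TM n M → ℝ) {x₀ : M} {v : TM n M}
    (hx : v.1 ∈ (chartAt (Model n) x₀).source) : localRep L x₀ (coords x₀ v) = L v := by
  have h : (extChartAt (𝓡 (n + 1)) x₀).symm (extChartAt (𝓡 (n + 1)) x₀ v.1) = v.1 :=
    (extChartAt (𝓡 (n + 1)) x₀).left_inv (by rwa [extChartAt_source])
  have h' : ∀ y, y = v.1 → L ⟨y, tanCoordInv x₀ y (tanCoord x₀ v.1 v.2)⟩ = L v := by
    rintro _ rfl
    rw [tanCoordInv_tanCoord hx]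
  exact h' _ h

theorem gForm_apply (L : TM n M → ℝ) (v : TM n M) (x y : Tan n v.1) :
    gForm L v x y = ∑ α, ∑ β, tanCoord v.1 v.1 x α * tanCoord v.1 v.1 y β *
      gMat (localRep L v.1) (coords v.1 v) α β := rfl

theorem curvEndo_apply (L : TM n M → ℝ) (v : TM n M) (w : Tan n v.1) :
    curvEndo L v w = tanCoordInv v.1 v.1
      (Matrix.toEuclideanLin (curvMat (localRep L v.1) (coords v.1 v)) (tanCoord v.1 v.1 w)) := rfl

namespace FinslerSpacetime

variable (S : FinslerSpacetime n M)

theorem fibreHomogeneous_localRep (x₀ : M) : FibreHomogeneous 2 (localRep S.L x₀) :=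
  fun c hc x v => by
    simp only [localRep, map_smul]
    exact S.homogeneous ⟨_, _⟩ c hc

/-- `localRep S.L x₀` is `L` composed with the inverse of a bundle chart of `TM`. -/
theorem contDiffAt_localRep (x₀ : M) {p : Model n × Model n}
    (hp : p.1 ∈ (extChartAt (𝓡 (n + 1)) x₀).target) (hp2 : p.2 ≠ 0) :
    ContDiffAt ℝ ∞ (localRep S.L x₀) p := by
  set e := trivializationAt (Model n) (TangentSpace (𝓡 (n + 1)) : M → Type _) x₀
  set U : Set (Model n × Model n) := {q | q.1 ∈ (extChartAt (𝓡 (n + 1)) x₀).target ∧ q.2 ≠ 0}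
  have hU : IsOpen U := ((isOpen_extChartAt_target x₀).preimage continuous_fst).inter
    (isOpen_ne.preimage continuous_snd)
  have hbase : ∀ q ∈ U, (extChartAt (𝓡 (n + 1)) x₀).symm q.1 ∈ (chartAt (Model n) x₀).source :=
    fun q hq => by
      have := (extChartAt (𝓡 (n + 1)) x₀).map_target hq.1
      rwa [extChartAt_source] at this
  have h1 : ContMDiffOn 𝓘(ℝ, Model n × Model n) ((𝓡 (n + 1)).prod 𝓘(ℝ, Model n)) ∞
      (fun q : Model n × Model n => ((extChartAt (𝓡 (n + 1)) x₀).symm q.1, q.2)) U :=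
    ((contMDiffOn_extChartAt_symm x₀).comp contDiff_fst.contMDiff.contMDiffOn
      fun q hq => hq.1).prodMk contDiff_snd.contMDiff.contMDiffOn
  have h2 : ContMDiffOn 𝓘(ℝ, Model n × Model n) (𝓡 (n + 1)).tangent ∞
      (fun q : Model n × Model n =>
        e.toOpenPartialHomeomorph.symm ((extChartAt (𝓡 (n + 1)) x₀).symm q.1, q.2)) U :=
    e.contMDiffOn_symm.comp h1 fun q hq => e.mem_target.2 (hbase q hq)
  have h3 : EqOn (fun q : Model n × Model n =>
      e.toOpenPartialHomeomorph.symm ((extChartAt (𝓡 (n + 1)) x₀).symm q.1, q.2))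
      (fun q => (⟨(extChartAt (𝓡 (n + 1)) x₀).symm q.1,
        tanCoordInv x₀ ((extChartAt (𝓡 (n + 1)) x₀).symm q.1) q.2⟩ : TM n M)) U := fun q hq =>
    (e.mk_symm (hbase q hq) q.2).symm.trans
      (congrArg _ (e.symmL_apply (R := ℝ) (hbase q hq) q.2).symm)
  have h4 : ContMDiffOn 𝓘(ℝ, Model n × Model n) 𝓘(ℝ, ℝ) ∞ (localRep S.L x₀) U := by
    refine S.smooth.comp (h2.congr fun q hq => (h3 hq).symm) fun q hq h => hq.2 ?_
    rw [← tanCoord_tanCoordInv (hbase q hq) q.2]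
    exact (congrArg _ h).trans (map_zero _)
  exact (h4.contMDiffAt (hU.mem_nhds ⟨hp, hp2⟩)).contDiffAt

theorem contDiffAt_localRep_coords (v : TM n M) (hv : v.2 ≠ 0) :
    ContDiffAt ℝ ∞ (localRep S.L v.1) (coords v.1 v) :=
  S.contDiffAt_localRep v.1 (mem_extChartAt_target v.1)
    (tanCoord_ne_zero (mem_chart_source _ _) hv)

theorem gForm_symm {v : TM n M} (hv : v.2 ≠ 0) (x y : Tan n v.1) :
    gForm S.L v x y = gForm S.L v y x := by
  obtain ⟨b, hb⟩ := S.signature v hv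
  have h : gForm S.L v = (gForm S.L v).flip := b.ext fun i => b.ext fun j => by
    rw [LinearMap.flip_apply, hb, hb]
    by_cases hij : i = j
    · simp [hij]
    · simp [hij, Ne.symm hij]
  exact congrArg (fun T => T x y) h

/-- `g_v(v, v) = 2 L(v)`. -/
theorem gForm_self {v : TM n M} (hv : v.2 ≠ 0) : gForm S.L v v.2 v.2 = 2 * S.L v := by
  rw [← localRep_coords S.L (mem_chart_source (Model n) v.1),
    ← gMat_fibre_fibre (S.contDiffAt_localRep_coords v hv) (S.fibreHomogeneous_localRep v.1)]
  rfl

theorem gForm_pos_of_mem_orth {v : TM n M} (hv : v.2 ≠ 0) (hL : S.L v < 0) {w : Tan n v.1}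
    (hw : w ∈ S.orth v) (h0 : w ≠ 0) : 0 < gForm S.L v w w := by
  obtain ⟨b, hb⟩ := S.signature v hv
  exact lorentz_pos_of_orthogonal _ b hb (v := v.2) (by rw [S.gForm_self hv]; linarith) hw h0

/-- Non-degeneracy of `g_v`, in coordinates. -/
theorem det_gMat_ne_zero {v : TM n M} (hv : v.2 ≠ 0) :
    (gMat (localRep S.L v.1) (coords v.1 v)).det ≠ 0 := by
  intro h
  obtain ⟨y, hy, h⟩ := Matrix.exists_mulVec_eq_zero_iff.2 h
  obtain ⟨b, hb⟩ := S.signature v hv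
  set w : Tan n v.1 := tanCoordInv v.1 v.1 (WithLp.toLp 2 y) with hw
  have hcw : tanCoord v.1 v.1 w = WithLp.toLp 2 y :=
    tanCoord_tanCoordInv (mem_chart_source _ _) _
  have hg : ∀ x, gForm S.L v x w = 0 := fun x => by
    rw [gForm_apply, hcw]
    refine Finset.sum_eq_zero fun α _ => ?_
    have := congrFun h α
    simp only [Matrix.mulVec, dotProduct, Pi.zero_apply] at this
    rw [← mul_zero (tanCoord v.1 v.1 x α), ← this, Finset.mul_sum]
    exact Finset.sum_congr rfl fun β _ => by ring
  have hrepr : ∀ i, b.repr w i = 0 := fun i => by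
    have h1 := hg (b i)
    rw [← b.sum_repr w, map_sum, Finset.sum_eq_single i] at h1
    · rw [map_smul, hb, if_pos rfl, smul_eq_mul] at h1
      split_ifs at h1 <;> simpa using h1
    · intro j _ hj
      rw [map_smul, hb, if_neg hj.symm, smul_zero]
    · simp
  have hw0 : w = 0 := b.repr.map_eq_zero_iff.1 (Finsupp.ext hrepr)
  rw [hw0, map_zero] at hcw
  exact hy (by simpa using congrArg WithLp.ofLp hcw.symm)

/-- `R_v(v) = 0`. -/
theorem curvEndo_self {v : TM n M} (hv : v.2 ≠ 0) : curvEndo S.L v v.2 = 0 := by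
  rw [curvEndo_apply]
  have h : Matrix.toEuclideanLin (curvMat (localRep S.L v.1) (coords v.1 v))
      (tanCoord v.1 v.1 v.2) = 0 := by
    ext α
    exact curvMat_mulVec_fibre (S.contDiffAt_localRep_coords v hv)
      (S.fibreHomogeneous_localRep v.1) (S.det_gMat_ne_zero hv) α
  rw [h, map_zero]

theorem curvEndo_smul (v : TM n M) {c : ℝ} (hc : 0 < c) :
    curvEndo S.L ⟨v.1, c • v.2⟩ = c ^ 2 • curvEndo S.L v := by
  ext w
  rw [curvEndo_apply, LinearMap.smul_apply, curvEndo_apply, coords_smul,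
    curvMat_scale (S.fibreHomogeneous_localRep v.1) hc]
  simp

theorem ricci_smul (v : TM n M) {c : ℝ} (hc : 0 < c) :
    ricci S.L ⟨v.1, c • v.2⟩ = c ^ 2 * ricci S.L v := by
  rw [ricci, S.curvEndo_smul v hc]
  exact map_smul _ _ _

/-! ### The orthogonal complement of a timelike vector -/

theorem orthProj_coe {v : TM n M} (hg : gForm S.L v v.2 v.2 ≠ 0) (w : Tan n v.1) :
    (S.orthProj v w : Tan n v.1) =
      w - ((gForm S.L v v.2 v.2)⁻¹ * gForm S.L v v.2 w) • v.2 := by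
  rw [orthProj, dif_pos hg]
  simp

theorem orthProj_of_mem {v : TM n M} (hg : gForm S.L v v.2 v.2 ≠ 0) (w : S.orth v) :
    S.orthProj v w = w := by
  have : gForm S.L v v.2 w = 0 := w.2
  ext
  rw [S.orthProj_coe hg, this]
  simp

theorem orthProj_self {v : TM n M} (hg : gForm S.L v v.2 v.2 ≠ 0) : S.orthProj v v.2 = 0 := by
  ext
  rw [S.orthProj_coe hg, inv_mul_cancel₀ hg]
  simp

theorem finrank_orth {v : TM n M} (hg : gForm S.L v v.2 v.2 ≠ 0) :
    Module.finrank ℝ (S.orth v) = n := by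
  have h1 := LinearMap.finrank_range_add_finrank_ker (gForm S.L v v.2)
  have h2 : LinearMap.range (gForm S.L v v.2) = ⊤ :=
    LinearMap.range_eq_top.2 (LinearMap.surjective fun h => hg (by rw [h]; rfl))
  have h3 : Module.finrank ℝ (Tan n v.1) = n + 1 := by
    have : Module.finrank ℝ (Model n) = n + 1 := by simp
    exact this
  rw [h2, finrank_top, Module.finrank_self, h3] at h1
  exact Nat.add_left_cancel (h1.trans (add_comm n 1))

/-- If `R_v` preserves `v^⊥`, its trace is that of its restriction, since `R_v(v) = 0`. -/
theorem ricci_eq_trace {v : TM n M} (hv : v.2 ≠ 0) (hg : gForm S.L v v.2 v.2 ≠ 0)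
    (R : Module.End ℝ (S.orth v)) (hR : ∀ w, (R w : Tan n v.1) = curvEndo S.L v w) :
    ricci S.L v = LinearMap.trace ℝ _ R := by
  have h : curvEndo S.L v = (S.orth v).subtype ∘ₗ (R ∘ₗ S.orthProj v) := by
    ext w
    simp only [LinearMap.comp_apply, Submodule.subtype_apply, hR, S.orthProj_coe hg, map_sub,
      map_smul, S.curvEndo_self hv, smul_zero, sub_zero]
  rw [ricci, h, LinearMap.trace_comp_comm']
  congr 1
  ext w
  simp [S.orthProj_of_mem hg]

end FinslerSpacetime

end TangentSpace

namespace FinslerSpacetime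

/-! ### Geodesics, their affine reparametrizations and the weighted Ricci curvature -/

section Geodesics

variable {n : ℕ} {M : Type*} [TopologicalSpace M] [ChartedSpace (Model n) M]

theorem isOpen_interval (a b : EReal) : IsOpen (interval a b) :=
  (isOpen_Ioi.preimage continuous_coe_real_ereal).inter
    (isOpen_Iio.preimage continuous_coe_real_ereal)

theorem Icc_subset_interval {a b : EReal} {p q : ℝ} (hp : p ∈ interval a b)
    (hq : q ∈ interval a b) : Icc p q ⊆ interval a b := fun _ ht =>
  ⟨hp.1.trans_le (EReal.coe_le_coe_iff.2 ht.1), (EReal.coe_le_coe_iff.2 ht.2).trans_lt hq.2⟩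

theorem velocity_comp_affine {η : ℝ → M} {t c s : ℝ}
    (hη : MDifferentiableAt 𝓘(ℝ, ℝ) (𝓡 (n + 1)) η (t + c * s)) :
    velocity (n := n) (fun s => η (t + c * s)) s =
      ⟨η (t + c * s), c • (velocity (n := n) η (t + c * s)).2⟩ := by
  have h1 : HasDerivAt (fun s : ℝ => t + c * s) c s := by
    simpa using ((hasDerivAt_id s).const_mul c).const_add t
  have h2 : HasMFDerivAt 𝓘(ℝ, ℝ) 𝓘(ℝ, ℝ) (fun s : ℝ => t + c * s) s
      (ContinuousLinearMap.toSpanSingleton ℝ c) := h1.hasFDerivAt.hasMFDerivAt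
  have h3 := (hη.hasMFDerivAt.comp s h2).mfderiv
  have h4 : mfderiv 𝓘(ℝ, ℝ) (𝓡 (n + 1)) (fun s => η (t + c * s)) s (1 : ℝ) =
      c • (velocity (n := n) η (t + c * s)).2 := by
    change mfderiv 𝓘(ℝ, ℝ) (𝓡 (n + 1)) (η ∘ fun s => t + c * s) s (1 : ℝ) = _
    rw [h3]
    have h5 : ∀ T : ℝ →L[ℝ] Tan n (η (t + c * s)), T ((1 : ℝ) • c) = c • T 1 := fun T => by
      rw [← map_smul]; simp
    exact h5 _
  exact congrArg (fun w => (⟨η (t + c * s), w⟩ : TM n M)) h4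

theorem IsEpsProperTime.monotoneOn {ψ : TM n M → ℝ} {ε : ℝ} {η : ℝ → M} {a b : EReal} {τ : ℝ → ℝ}
    (hτ : IsEpsProperTime (n := n) ψ ε η a b τ) : MonotoneOn τ (interval a b) :=
  fun p hp q hq hpq => by
  have hI := Icc_subset_interval hp hq
  exact monotoneOn_of_hasDerivWithinAt_nonneg (convex_Icc p q)
    (fun t ht => (hτ t (hI ht)).continuousAt.continuousWithinAt)
    (fun t ht => (hτ t (hI (interior_subset ht))).hasDerivWithinAt) (fun t _ => (Real.exp_pos _).le)
    (left_mem_Icc.2 hpq) (right_mem_Icc.2 hpq) hpq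

variable [IsManifold (𝓡 (n + 1)) ∞ M]

theorem contMDiffOn_velocity {η : ℝ → M} {a b : EReal}
    (hη : ContMDiffOn 𝓘(ℝ, ℝ) (𝓡 (n + 1)) ∞ η (interval a b)) :
    ContMDiffOn 𝓘(ℝ, ℝ) (𝓡 (n + 1)).tangent ∞ (velocity (n := n) η) (interval a b) := by
  have hu := (isOpen_interval a b).uniqueMDiffOn (I := 𝓘(ℝ, ℝ))
  have h1 := hη.contMDiffOn_tangentMapWithin (m := ∞) (by simp) hu
  have h2 : ContMDiff 𝓘(ℝ, ℝ) 𝓘(ℝ, ℝ).tangent ∞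
      (fun t : ℝ => (⟨t, (1 : ℝ)⟩ : TangentBundle 𝓘(ℝ, ℝ) ℝ)) :=
    contMDiff_vectorSpace_iff_contDiff.2 contDiff_const
  refine (h1.comp h2.contMDiffOn fun t ht => ht).congr fun t ht => ?_
  simp only [velocity, Function.comp_apply, tangentMapWithin]
  rw [mfderivWithin_of_isOpen (isOpen_interval a b) ht]

variable {S : FinslerSpacetime n M}

/-- The future cone is invariant under positive scaling: a ray is connected. -/
theorem IsFutureCausal.smul {v : TM n M} (hv : S.IsFutureCausal v) {c : ℝ} (hc : 0 < c) :
    S.IsFutureCausal ⟨v.1, c • v.2⟩ := by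
  obtain ⟨h1, h2, h3⟩ := hv
  refine ⟨?_, smul_ne_zero hc.ne' h2, ?_⟩
  · rw [S.homogeneous v c hc]
    exact mul_nonpos_of_nonneg_of_nonpos (sq_nonneg c) h1
  · have hcl : v.2 ∈ closure (S.timelike v.1) := (connectedComponentIn_subset _ _ h3).1
    have hray : (fun s : ℝ => s • v.2) '' Ioi 0 ⊆ closure (S.timelike v.1) \ {0} := by
      rintro _ ⟨s, hs, rfl⟩
      refine ⟨map_mem_closure (continuous_const_smul s) hcl fun w hw => ?_,
        smul_ne_zero (ne_of_gt hs) h2⟩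
      have := S.homogeneous ⟨v.1, w⟩ s hs
      change S.L ⟨v.1, s • w⟩ < 0
      rw [this]
      exact mul_neg_of_pos_of_neg (pow_pos hs 2) hw
    rw [connectedComponentIn_eq h3]
    refine (isPreconnected_Ioi.image _ (Continuous.continuousOn
      (continuous_id.smul continuous_const))).subset_connectedComponentIn
      ⟨1, zero_lt_one, one_smul ℝ v.2⟩ hray ⟨c, hc, rfl⟩

theorem IsUnitTimelikeGeodesic.mem_futureTimelike {η : ℝ → M} {a b : EReal}
    (hη : S.IsUnitTimelikeGeodesic η a b) {t : ℝ} (ht : t ∈ interval a b) :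
    (velocity (n := n) η t).2 ∈ S.futureTimelike (η t) :=
  ⟨(hη.2 t ht).1, hη.1.2.1 t ht⟩

theorem contDiffOn_weightAlong {ψ : TM n M → ℝ} (hψ : S.IsWeight ψ) {η : ℝ → M} {a b : EReal}
    (hη : S.IsUnitTimelikeGeodesic η a b) :
    ContDiffOn ℝ ∞ (weightAlong (n := n) ψ η) (interval a b) := by
  have h := hψ.1.comp (contMDiffOn_velocity hη.1.1) fun t ht =>
    ⟨subset_closure (hη.mem_futureTimelike ht), (hη.1.2.1 t ht).2.1⟩
  exact h.contDiffOn

/-- Positive affine reparametrizations of geodesics are geodesics, as `Γ̃` is positively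
`0`-homogeneous in the velocity. -/
theorem IsCausalGeodesic.comp_affine {η : ℝ → M} {a b a' b' : EReal}
    (hη : S.IsCausalGeodesic η a b) {t c : ℝ} (hc : 0 < c)
    (hmaps : ∀ s ∈ interval a' b', t + c * s ∈ interval a b) :
    S.IsCausalGeodesic (fun s => η (t + c * s)) a' b' := by
  obtain ⟨h1, h2, h3⟩ := hη
  have hd : ∀ s ∈ interval a' b', MDifferentiableAt 𝓘(ℝ, ℝ) (𝓡 (n + 1)) η (t + c * s) :=
    fun s hs => (h1.contMDiffAt ((isOpen_interval a b).mem_nhds (hmaps s hs))).mdifferentiableAt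
      (by simp)
  have hvel := fun s hs => velocity_comp_affine (n := n) (hd s hs)
  refine ⟨?_, fun s hs => ?_, fun x₀ s hs hx α => ?_⟩
  · have : ContDiff ℝ ∞ (fun s : ℝ => t + c * s) := by fun_prop
    exact h1.comp this.contMDiff.contMDiffOn hmaps
  · rw [hvel s hs]
    exact (h2 _ (hmaps s hs)).smul hc
  · have hc0 : ∀ r ∈ interval a' b', coords x₀ (velocity (n := n) (fun s => η (t + c * s)) r) =
        ((coords x₀ (velocity (n := n) η (t + c * r))).1,
          c • (coords x₀ (velocity (n := n) η (t + c * r))).2) := fun r hr => by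
      rw [hvel r hr]
      exact coords_smul x₀ (velocity (n := n) η (t + c * r)) c
    have haff : HasDerivAt (fun s : ℝ => t + c * s) c s := by
      simpa using ((hasDerivAt_id s).const_mul c).const_add t
    have h4 := (((h3 x₀ _ (hmaps s hs) hx α).comp s haff).const_mul c).congr_of_eventuallyEq
      (f₁ := fun r => (coords x₀ (velocity (n := n) (fun s => η (t + c * s)) r)).2 α) (by
        filter_upwards [(isOpen_interval a' b').mem_nhds hs] with r hr
        rw [hc0 r hr]
        rfl)
    refine h4.congr_deriv ?_
    rw [hc0 s hs]
    have h5 := fun β γ => fibreHomogeneous_christoffelTilde (S.fibreHomogeneous_localRep x₀) α β γ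
      c hc (coords x₀ (velocity (n := n) η (t + c * s))).1
      (coords x₀ (velocity (n := n) η (t + c * s))).2
    simp only [pow_zero, one_mul, Prod.mk.eta] at h5
    simp only [h5, PiLp.smul_apply, smul_eq_mul, mul_neg, neg_mul, Finset.mul_sum, Finset.sum_mul]
    congr 1
    exact Finset.sum_congr rfl fun β _ => Finset.sum_congr rfl fun γ _ => by ring

/-- The weighted Ricci curvature of a positive multiple `c η̇(t)` of the velocity of a geodesic,
computed along `s ↦ η(t + c s)`. -/
theorem isWeightedRicci_smul_velocity {ψ : TM n M → ℝ} (hψ : S.IsWeight ψ) {η : ℝ → M}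
    {a b : EReal} (hη : S.IsUnitTimelikeGeodesic η a b) {t c : ℝ} (ht : t ∈ interval a b)
    (hc : 0 < c) (N : WithTop ℝ) :
    S.IsWeightedRicci ψ N ⟨η t, c • (velocity (n := n) η t).2⟩ (match N with
      | ⊤ => ((c ^ 2 * (ricci S.L (velocity (n := n) η t)
          + deriv (deriv (weightAlong (n := n) ψ η)) t) : ℝ) : EReal)
      | (N : ℝ) =>
        if N = n then
          if deriv (weightAlong (n := n) ψ η) t = 0 then
            ((c ^ 2 * (ricci S.L (velocity (n := n) η t)
              + deriv (deriv (weightAlong (n := n) ψ η)) t) : ℝ) : EReal)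
          else ⊥
        else
          ((c ^ 2 * (ricci S.L (velocity (n := n) η t)
            + deriv (deriv (weightAlong (n := n) ψ η)) t
            - deriv (weightAlong (n := n) ψ η) t ^ 2 / (N - n)) : ℝ) : EReal)) := by
  -- The reparametrized geodesic is defined for `|s| < r / c`.
  obtain ⟨r, hr, hball⟩ := Metric.isOpen_iff.1 (isOpen_interval a b) t ht
  have hmaps : ∀ s ∈ interval ((-(r / c) : ℝ) : EReal) ((r / c : ℝ) : EReal),
      t + c * s ∈ interval a b := fun s hs => hball (by
    have h1 : -(r / c) < s := EReal.coe_lt_coe_iff.1 hs.1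
    have h2 : s < r / c := EReal.coe_lt_coe_iff.1 hs.2
    have h3 : |s| < r / c := abs_lt.2 ⟨h1, h2⟩
    rw [lt_div_iff₀ hc] at h3
    rw [Metric.mem_ball, Real.dist_eq, add_sub_cancel_left, abs_mul, abs_of_pos hc]
    linarith)
  have hσ := hη.1.comp_affine hc hmaps
  set σ : ℝ → M := fun s => η (t + c * s)
  have hr' : 0 < r / c := div_pos hr hc
  have hopen := isOpen_interval ((-(r / c) : ℝ) : EReal) ((r / c : ℝ) : EReal)
  have h0 : (0 : ℝ) ∈ interval ((-(r / c) : ℝ) : EReal) ((r / c : ℝ) : EReal) :=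
    ⟨EReal.coe_lt_coe_iff.2 (neg_neg_of_pos hr'), EReal.coe_lt_coe_iff.2 hr'⟩
  have hvel : ∀ s ∈ interval ((-(r / c) : ℝ) : EReal) ((r / c : ℝ) : EReal),
      velocity (n := n) σ s = ⟨η (t + c * s), c • (velocity (n := n) η (t + c * s)).2⟩ :=
    fun s hs => velocity_comp_affine
      ((hη.1.1.contMDiffAt ((isOpen_interval a b).mem_nhds (hmaps s hs))).mdifferentiableAt
        (by simp))
  have hv0 : velocity (n := n) σ 0 = ⟨η t, c • (velocity (n := n) η t).2⟩ := by
    have h := hvel 0 h0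
    have h' : ∀ y, y = t → (⟨η y, c • (velocity (n := n) η y).2⟩ : TM n M) =
      ⟨η t, c • (velocity (n := n) η t).2⟩ := by rintro _ rfl; rfl
    exact h.trans (h' _ (by simp))
  have hw : ∀ s ∈ interval ((-(r / c) : ℝ) : EReal) ((r / c : ℝ) : EReal),
      weightAlong (n := n) ψ σ s = weightAlong (n := n) ψ η (t + c * s) := fun s hs => by
    simp only [weightAlong, hvel s hs]
    exact hψ.2 (velocity (n := n) η (t + c * s))
      (subset_closure (hη.mem_futureTimelike (hmaps s hs))) (hη.1.2.1 _ (hmaps s hs)).2.1 c hc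
  have hderiv : ∀ (f : ℝ → ℝ) (s : ℝ), deriv (fun s => f (t + c * s)) s =
      c * deriv f (t + c * s) := fun f s => by
    have h1 := deriv_comp_mul_left c (fun y => f (t + y)) s
    rw [h1, deriv_comp_const_add, smul_eq_mul]
  have hd1 : ∀ s ∈ interval ((-(r / c) : ℝ) : EReal) ((r / c : ℝ) : EReal),
      deriv (weightAlong (n := n) ψ σ) s = c * deriv (weightAlong (n := n) ψ η) (t + c * s) :=
    fun s hs => by
    rw [← hderiv]
    refine Filter.EventuallyEq.deriv_eq ?_
    filter_upwards [hopen.mem_nhds hs] with y hy using hw y hy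
  have hd10 : deriv (weightAlong (n := n) ψ σ) 0 = c * deriv (weightAlong (n := n) ψ η) t := by
    simpa using hd1 0 h0
  have hd20 : deriv (deriv (weightAlong (n := n) ψ σ)) 0 =
      c ^ 2 * deriv (deriv (weightAlong (n := n) ψ η)) t := by
    have : deriv (weightAlong (n := n) ψ σ) =ᶠ[𝓝 0]
        fun s => c * deriv (weightAlong (n := n) ψ η) (t + c * s) := by
      filter_upwards [hopen.mem_nhds h0] with y hy using hd1 y hy
    rw [this.deriv_eq]
    simp only [deriv_const_mul_field', hderiv]
    simp [sq, mul_assoc]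
  refine ⟨r / c, σ, hr', hσ, hv0, ?_⟩
  have hric := S.ricci_smul (velocity (n := n) η t) hc
  change ricci S.L ⟨η t, _⟩ = _ at hric
  rw [hd10, hd20, hric]
  have hp : c * deriv (weightAlong (n := n) ψ η) t = 0 ↔
      deriv (weightAlong (n := n) ψ η) t = 0 := by simp [hc.ne']
  cases N with
  | top => simp only [mul_add]
  | coe N =>
    simp only [hp]
    split_ifs
    · simp only [mul_add]
    · rfl
    · congr 1; ring

end Geodesics

end FinslerSpacetime

/-! ### The weighted curvature-dimension inequality -/

/-- The condition `Ric_N ≥ 0` in terms of `ρ = Ric`, `p = ψ_η'` and `q = ψ_η''`. For `N = n` it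
includes `p = 0`, since `Ric_n = -∞` otherwise. -/
def RicciBound (n : ℕ) (N : WithTop ℝ) (ρ p q : ℝ) : Prop :=
  match N with
  | ⊤ => 0 ≤ ρ + q
  | (N : ℝ) => if N = n then p = 0 ∧ 0 ≤ ρ + q else 0 ≤ ρ + q - p ^ 2 / (N - n)

theorem cConst_pos {n : ℕ} (hn : 1 ≤ n) {N : WithTop ℝ}
    (hN : N ≤ ((0 : ℝ) : WithTop ℝ) ∨ ((n : ℝ) : WithTop ℝ) ≤ N) {ε : ℝ} (hε : EpsRange n N ε) :
    0 < cConst n N ε := by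
  have hn' : (0 : ℝ) < n := by exact_mod_cast hn
  cases N with
  | top =>
    have h : |ε| < 1 := hε
    have := (sq_lt_one_iff_abs_lt_one ε).2 h
    have : 0 < 1 / (n : ℝ) * (1 - ε ^ 2) := mul_pos (by positivity) (by linarith)
    exact this
  | coe N =>
    simp only [cConst]
    simp only [EpsRange] at hε
    by_cases h0 : N = 0
    · rw [if_pos h0]; positivity
    rw [if_neg h0] at hε ⊢
    refine mul_pos (by positivity) ?_
    by_cases hNn : N = n
    · simp [hNn]
    rw [if_neg hNn] at hε
    rw [Real.lt_sqrt (abs_nonneg _), sq_abs] at hε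
    have hNn' : N - n ≠ 0 := sub_ne_zero.2 hNn
    have hpos : 0 < N / (N - n) := by
      rcases hN with h | h
      · have h := WithTop.coe_le_coe.1 h
        exact div_pos_of_neg_of_neg (lt_of_le_of_ne h h0) (by linarith)
      · have h := WithTop.coe_le_coe.1 h
        have h2 := lt_of_le_of_ne h (Ne.symm hNn)
        exact div_pos (by linarith) (by linarith)
    have : ε ^ 2 * ((N - n) / N) < 1 := by
      rw [← inv_div, ← div_eq_mul_inv, div_lt_one hpos]
      exact hε
    linarith

/-- With `ρ = Ric`, `p = ψ'`, `q = ψ''` and `u = θ - ψ'`, the condition `Ric_N ≥ 0`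
makes the right-hand side of the weighted Riccati equation at most `-c u²`, because
`ε² (N-n)/N u² + 2 ε u p + N/(N-n) p²` is a complete square. -/
theorem weighted_quadratic_le {n : ℕ} (hn : 1 ≤ n) {N : WithTop ℝ}
    (hN : N ≤ ((0 : ℝ) : WithTop ℝ) ∨ ((n : ℝ) : WithTop ℝ) ≤ N) {ε : ℝ} (hε : EpsRange n N ε)
    {ρ p q : ℝ} (h : RicciBound n N ρ p q) (u : ℝ) :
    -ρ - q - (u + p) ^ 2 / n + 2 * (1 - ε) / n * p * u ≤ -(cConst n N ε * u ^ 2) := by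
  have hn' : (0 : ℝ) < n := by exact_mod_cast hn
  cases N with
  | top =>
    have h : 0 ≤ ρ + q := h
    have e : cConst n ⊤ ε = 1 / n * (1 - ε ^ 2) := rfl
    have key : -((u + p) ^ 2 / n) + 2 * (1 - ε) / n * p * u + 1 / n * (1 - ε ^ 2) * u ^ 2 =
        -((ε * u + p) ^ 2 / n) := by field_simp; ring
    have : 0 ≤ (ε * u + p) ^ 2 / n := by positivity
    rw [e]; linarith
  | coe N =>
    simp only [RicciBound] at h
    by_cases hNn : N = n
    · rw [if_pos hNn] at h
      obtain ⟨rfl, h⟩ := h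
      have e : cConst n (N : ℝ) ε = 1 / n := by simp [cConst, hNn]
      rw [e]
      have : (u + 0) ^ 2 / n = 1 / n * u ^ 2 := by ring
      linarith
    · rw [if_neg hNn] at h
      have hNn' : N - n ≠ 0 := sub_ne_zero.2 hNn
      by_cases hN0 : N = 0
      · have hε0 : ε = 0 := by simpa [EpsRange, hN0] using hε
        have e : cConst n (N : ℝ) ε = 1 / n := by simp [cConst, hN0]
        rw [e, hε0]
        have key : -((u + p) ^ 2 / n) + 2 * (1 - 0) / n * p * u + 1 / n * u ^ 2 =
          p ^ 2 / (N - n) := by rw [hN0, zero_sub]; field_simp; ring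
        linarith
      · have e : cConst n (N : ℝ) ε = 1 / n * (1 - ε ^ 2 * ((N - n) / N)) := by
          simp [cConst, hN0]
        have hpos : 0 < N / (N - n) := by
          rcases hN with h | h
          · have h := WithTop.coe_le_coe.1 h
            exact div_pos_of_neg_of_neg (lt_of_le_of_ne h hN0) (by linarith)
          · have h := WithTop.coe_le_coe.1 h
            have h2 := lt_of_le_of_ne h (Ne.symm hNn)
            exact div_pos (by linarith) (by linarith)
        have key : -(p ^ 2 / (N - n)) - (u + p) ^ 2 / n + 2 * (1 - ε) / n * p * u
            + 1 / n * (1 - ε ^ 2 * ((N - n) / N)) * u ^ 2 =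
            -(N / (N - n) * (p + ε * ((N - n) / N) * u) ^ 2 / n) := by
          field_simp; ring
        have : 0 ≤ N / (N - n) * (p + ε * ((N - n) / N) * u) ^ 2 / n := by positivity
        rw [e]; linarith

namespace FinslerSpacetime

/-! ### The Raychaudhuri equation along a geodesic -/

section Raychaudhuri

variable {n : ℕ} {M : Type*} [TopologicalSpace M] [ChartedSpace (Model n) M]
  [IsManifold (𝓡 (n + 1)) ∞ M] {S : FinslerSpacetime n M} {η : ℝ → M}

/-- The components, in the chart around `x₀`, of the endomorphism of `T_xM` that equals `A` on the
orthogonal complement of `v ∈ T_xM` and vanishes on `v`. -/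
noncomputable def extMat (x₀ : M) {v : TM n M} (A : Module.End ℝ (S.orth v)) :
    Matrix (Fin (n + 1)) (Fin (n + 1)) ℝ :=
  Matrix.of fun α β =>
    tanCoord x₀ v.1 (A (S.orthProj v (tanCoordInv x₀ v.1 (EuclideanSpace.single β 1)))).1 α

/-- The endomorphism of the model space with matrix `extMat x₀ A`. -/
noncomputable def extLin (x₀ : M) {v : TM n M} (A : Module.End ℝ (S.orth v)) :
    Module.End ℝ (Model n) :=
  ((tanCoord x₀ v.1).toLinearMap ∘ₗ (S.orth v).subtype ∘ₗ A) ∘ₗ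
    (S.orthProj v ∘ₗ (tanCoordInv x₀ v.1).toLinearMap)

theorem extMat_eq_toMatrix (x₀ : M) {v : TM n M} (A : Module.End ℝ (S.orth v)) :
    extMat x₀ A = LinearMap.toMatrix (EuclideanSpace.basisFun (Fin (n + 1)) ℝ).toBasis
      (EuclideanSpace.basisFun (Fin (n + 1)) ℝ).toBasis (extLin x₀ A) := by
  ext α β
  simp [extMat, extLin, LinearMap.toMatrix_apply]

theorem extMat_mulVec (x₀ : M) {v : TM n M} (A : Module.End ℝ (S.orth v)) (w : Model n) :
    extMat x₀ A *ᵥ w.ofLp = (extLin x₀ A w).ofLp := by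
  have h := LinearMap.toMatrix_mulVec_repr (EuclideanSpace.basisFun (Fin (n + 1)) ℝ).toBasis
    (EuclideanSpace.basisFun (Fin (n + 1)) ℝ).toBasis (extLin x₀ A) w
  rw [extMat_eq_toMatrix]
  exact h

section

variable {x₀ : M} {v : TM n M}

theorem extMat_mul (A B : Module.End ℝ (S.orth v)) (hx : v.1 ∈ (chartAt (Model n) x₀).source)
    (hg : gForm S.L v v.2 v.2 ≠ 0) : extMat x₀ (A * B) = extMat x₀ A * extMat x₀ B := by
  rw [extMat_eq_toMatrix, extMat_eq_toMatrix, extMat_eq_toMatrix, ← LinearMap.toMatrix_comp]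
  congr 1
  ext1 w
  simp only [extLin, LinearMap.comp_apply, Submodule.subtype_apply, ContinuousLinearMap.coe_coe,
    Module.End.mul_apply, tanCoordInv_tanCoord hx, S.orthProj_of_mem hg]

theorem trace_extMat (A : Module.End ℝ (S.orth v)) (hx : v.1 ∈ (chartAt (Model n) x₀).source)
    (hg : gForm S.L v v.2 v.2 ≠ 0) : (extMat x₀ A).trace = LinearMap.trace ℝ _ A := by
  rw [extMat_eq_toMatrix, ← LinearMap.trace_eq_matrix_trace, extLin, LinearMap.trace_comp_comm']
  congr 1
  ext1 w
  simp only [LinearMap.comp_apply, Submodule.subtype_apply, ContinuousLinearMap.coe_coe,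
    tanCoordInv_tanCoord hx, S.orthProj_of_mem hg]

theorem extMat_mulVec_self (A : Module.End ℝ (S.orth v))
    (hx : v.1 ∈ (chartAt (Model n) x₀).source) (hg : gForm S.L v v.2 v.2 ≠ 0) :
    extMat x₀ A *ᵥ (coords x₀ v).2.ofLp = 0 := by
  have h : extLin x₀ A (coords x₀ v).2 = 0 := by
    simp only [extLin, LinearMap.comp_apply, coords, ContinuousLinearMap.coe_coe,
      tanCoordInv_tanCoord hx, S.orthProj_self hg, map_zero]
  rw [extMat_mulVec, h]
  rfl

/-- The components in the chart around `x₀` of the covector `g_v(v, ·) / g_v(v, v)` at `v ∈ TM`. -/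
noncomputable def unitCovector (S : FinslerSpacetime n M) (x₀ : M) (v : TM n M)
    (α : Fin (n + 1)) : ℝ :=
  (gForm S.L v v.2 v.2)⁻¹ * gForm S.L v v.2 (tanCoordInv x₀ v.1 (EuclideanSpace.single α 1))

theorem unitCovector_dotProduct (w : Model n) : unitCovector S x₀ v ⬝ᵥ w.ofLp =
    (gForm S.L v v.2 v.2)⁻¹ * gForm S.L v v.2 (tanCoordInv x₀ v.1 w) := by
  conv_rhs => rw [eq_sum_single w]
  simp only [map_sum, map_smul, Finset.mul_sum, smul_eq_mul, dotProduct, unitCovector]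
  exact Finset.sum_congr rfl fun α _ => by ring

theorem unitCovector_dotProduct_self (hx : v.1 ∈ (chartAt (Model n) x₀).source)
    (hg : gForm S.L v v.2 v.2 ≠ 0) : unitCovector S x₀ v ⬝ᵥ (coords x₀ v).2.ofLp = 1 := by
  rw [unitCovector_dotProduct, coords, tanCoordInv_tanCoord hx, inv_mul_cancel₀ hg]

theorem unitCovector_vecMul_extMat (A : Module.End ℝ (S.orth v))
    (hx : v.1 ∈ (chartAt (Model n) x₀).source) : unitCovector S x₀ v ᵥ* extMat x₀ A = 0 := by
  ext β
  have h := unitCovector_dotProduct (S := S) (x₀ := x₀) (v := v) (tanCoord x₀ v.1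
    (A (S.orthProj v (tanCoordInv x₀ v.1 (EuclideanSpace.single β 1)))).1)
  have h0 : gForm S.L v v.2
      (A (S.orthProj v (tanCoordInv x₀ v.1 (EuclideanSpace.single β 1)))).1 = 0 := (A _).2
  rw [tanCoordInv_tanCoord hx, h0, mul_zero] at h
  exact h

theorem extMat_one (hx : v.1 ∈ (chartAt (Model n) x₀).source) (hg : gForm S.L v v.2 v.2 ≠ 0) :
    extMat x₀ (1 : Module.End ℝ (S.orth v)) =
      1 - Matrix.vecMulVec (coords x₀ v).2.ofLp (unitCovector S x₀ v) := by
  ext α β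
  simp only [extMat, Matrix.of_apply, Module.End.one_apply, S.orthProj_coe hg, map_sub, map_smul,
    tanCoord_tanCoordInv hx]
  simp [Matrix.one_apply, Matrix.vecMulVec_apply, coords, unitCovector, mul_comm]

end

variable {t : ℝ} {a b : EReal}

theorem IsUnitTimelikeGeodesic.gForm_ne_zero (hη : S.IsUnitTimelikeGeodesic η a b)
    (ht : t ∈ interval a b) :
    gForm S.L (velocity η t) (velocity η t).2 (velocity (n := n) η t).2 ≠ 0 := by
  rw [S.gForm_self (hη.1.2.1 t ht).2.1]
  have := (hη.2 t ht).1
  linarith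

/-- The Raychaudhuri equation `θ' = -Ric(η̇) - trace B²` for `θ = trace B`, `B = J' J⁻¹`. -/
theorem IsJacobiTensor.hasDerivWithinAt_trace_endoB (hη : S.IsUnitTimelikeGeodesic η a b)
    {J J' : S.OrthEndo η} (hJ : S.IsJacobiTensor a b J J') {I : Set ℝ} (hI : I ⊆ interval a b)
    (hu : ∀ s ∈ I, IsUnit (J s)) (ht : t ∈ I) :
    HasDerivWithinAt (fun s => LinearMap.trace ℝ _ (S.endoB J J' s))
      (-ricci S.L (velocity η t) - LinearMap.trace ℝ _ (S.endoB J J' t * S.endoB J J' t)) I t := by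
  obtain ⟨-, hJJ', ⟨J'', hJ'J'', hJ''⟩, -⟩ := hJ
  have hti := hI ht
  have hg := fun s (hs : s ∈ interval a b) => hη.gForm_ne_zero hs
  have hmat : ∀ (A : S.OrthEndo η) s, S.endoMat A (η t) s = extMat (η t) (A s) := fun _ _ => rfl
  -- The chart around `η t` is the one in which the curvature at `η t` is expressed.
  have hx : (velocity (n := n) η t).1 ∈ (chartAt (Model n) (η t)).source := mem_chart_source _ _
  set K : Module.End ℝ (S.orth (velocity η t)) := Ring.inverse (J t)
  have hJK : J t * K = 1 := Ring.mul_inverse_cancel _ (hu t ht)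
  have hKJ : K * J t = 1 := Ring.inverse_mul_cancel _ (hu t ht)
  have hB : S.endoB J J' t = J' t * K := rfl
  set V : ℝ → Matrix (Fin (n + 1)) (Fin (n + 1)) ℝ := fun s => Matrix.vecMulVec
    (coords (η t) (velocity (n := n) η s)).2.ofLp (unitCovector S (η t) (velocity η t)) with hV
  -- Only the vector in this rank-one term moves with `s`; the covector is the one at time `t`.
  obtain ⟨hev, hder⟩ := hasDerivAt_trace_riccati
    (v := fun s => (coords (η t) (velocity (n := n) η s)).2.ofLp)
    (ℓ := unitCovector S (η t) (velocity η t)) (K := extMat (η t) K)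
    (hJJ' (η t) t hti hx) (hJ'J'' (η t) t hti hx) (hη.1.2.2 (η t) t hti hx)
    (unitCovector_dotProduct_self hx (hg t hti))
    (extMat_mulVec_self (J t) hx (hg t hti)) (extMat_mulVec_self (J' t) hx (hg t hti))
    (extMat_mulVec_self (J'' t) hx (hg t hti)) (unitCovector_vecMul_extMat (J' t) hx)
    (unitCovector_vecMul_extMat K hx)
    (by rw [hmat, ← extMat_mul _ _ hx (hg t hti), ← extMat_one hx (hg t hti), hJK])
    (by rw [hmat, ← extMat_mul _ _ hx (hg t hti), ← extMat_one hx (hg t hti), hKJ])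
  have hcont : ContinuousAt η t :=
    (hη.1.1.contMDiffAt ((isOpen_interval a b).mem_nhds hti)).continuousAt
  have hsrc : ∀ᶠ s in 𝓝 t, η s ∈ (chartAt (Model n) (η t)).source :=
    hcont.eventually ((chartAt (Model n) (η t)).open_source.mem_nhds hx)
  have htrace : ∀ s ∈ I, (velocity (n := n) η s).1 ∈ (chartAt (Model n) (η t)).source →
      IsUnit (S.endoMat J (η t) s + V s) → LinearMap.trace ℝ _ (S.endoB J J' s) =
        (S.endoMat J' (η t) s * (S.endoMat J (η t) s + V s)⁻¹).trace := by
    intro s hs hxs hus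
    have h1 : extMat (η t) (S.endoB J J' s) * (S.endoMat J (η t) s + V s) =
        S.endoMat J' (η t) s := by
      have h2 : S.endoB J J' s * J s = J' s := by
        rw [endoB, mul_assoc, Ring.inverse_mul_cancel _ (hu s hs), mul_one]
      rw [mul_add, hmat, ← extMat_mul _ _ hxs (hg s (hI hs)), hV, Matrix.mul_vecMulVec,
        extMat_mulVec_self _ hxs (hg s (hI hs)), Matrix.zero_vecMulVec, add_zero, h2]
      rfl
    rw [← h1, Matrix.mul_nonsing_inv_cancel_right _ _ ((Matrix.isUnit_iff_isUnit_det _).1 hus),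
      trace_extMat _ hxs (hg s (hI hs))]
  -- `J` is invertible only on `I`, hence the one-sided derivative at boundary points of `I`.
  have hcongr : (fun s => LinearMap.trace ℝ _ (S.endoB J J' s)) =ᶠ[𝓝[I] t]
      fun s => (S.endoMat J' (η t) s * (S.endoMat J (η t) s + V s)⁻¹).trace := by
    filter_upwards [self_mem_nhdsWithin, mem_nhdsWithin_of_mem_nhds hsrc,
      mem_nhdsWithin_of_mem_nhds hev] with s h1 h2 h3 using htrace s h1 h2 h3
  refine (hder.hasDerivWithinAt.congr_of_eventuallyEq hcongr
    (htrace t ht hx hev.self_of_nhds)).congr_deriv ?_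
  rw [hmat, hmat, ← extMat_mul _ _ hx (hg t hti), ← extMat_mul _ _ hx (hg t hti),
    ← extMat_mul _ _ hx (hg t hti), trace_extMat _ hx (hg t hti), trace_extMat _ hx (hg t hti)]
  have hric : ricci S.L (velocity η t) = LinearMap.trace ℝ _ (-(J'' t * K)) := by
    refine S.ricci_eq_trace (hη.1.2.1 t hti).2.1 (hg t hti) _ fun w => ?_
    have h1 := hJ'' t hti (K w)
    have h2 : J t (K w) = w := congrArg (fun T => T w) hJK
    rw [h2] at h1
    exact neg_eq_of_add_eq_zero_right h1
  rw [hric, map_neg, neg_neg, hB]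

/-- `(trace B)² / n ≤ trace B²`, since the Lagrange condition makes `B = J' J⁻¹` symmetric for the
positive definite restriction of `g_η̇` to `N_η`. -/
theorem IsLagrangeTensor.sq_trace_endoB_le (hn : 1 ≤ n) (hη : S.IsUnitTimelikeGeodesic η a b)
    {J J' : S.OrthEndo η} (hJ : S.IsLagrangeTensor a b J J') (ht : t ∈ interval a b)
    (hu : IsUnit (J t)) :
    LinearMap.trace ℝ _ (S.endoB J J' t) ^ 2 / n ≤
      LinearMap.trace ℝ _ (S.endoB J J' t * S.endoB J J' t) := by
  have hv := (hη.1.2.1 t ht).2.1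
  have : FiniteDimensional ℝ (Tan n (velocity (n := n) η t).1) := finiteDimensional_tan _
  refine sq_trace_le_of_symmetric
    ((gForm S.L (velocity η t)).domRestrict₁₂ (S.orth (velocity η t)) (S.orth (velocity η t)))
    (fun x y => S.gForm_symm hv _ _)
    (fun x hx => S.gForm_pos_of_mem_orth hv (hη.2 t ht).1 x.2 fun h => hx (Subtype.ext h))
    _ (fun x y => ?_) hn (S.finrank_orth (hη.gForm_ne_zero ht))
  have h1 := hJ.2 t ht (Ring.inverse (J t) x) (Ring.inverse (J t) y)
  have h2 : ∀ w, J t (Ring.inverse (J t) w) = w := fun w =>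
    congrArg (fun T => T w) (Ring.mul_inverse_cancel _ hu)
  rw [h2, h2] at h1
  exact sub_eq_zero.1 h1

theorem expansion_eq (hη : S.IsUnitTimelikeGeodesic η a b) (hn : 1 ≤ n) (ψ : TM n M → ℝ) (ε : ℝ)
    (J J' : S.OrthEndo η) (ht : t ∈ interval a b) :
    S.expansion ψ ε J J' t = Real.exp (2 * (1 - ε) / n * weightAlong (n := n) ψ η t) *
      (LinearMap.trace ℝ _ (S.endoB J J' t) - deriv (weightAlong (n := n) ψ η) t) := by
  have hn' : (n : ℝ) ≠ 0 := by exact_mod_cast (by omega : n ≠ 0)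
  have : FiniteDimensional ℝ (Tan n (velocity (n := n) η t).1) := finiteDimensional_tan _
  rw [expansion, endoBEps, map_sub, map_smul, map_smul, LinearMap.trace_one,
    S.finrank_orth (hη.gForm_ne_zero ht), weightStar, smul_eq_mul, smul_eq_mul,
    div_mul_cancel₀ _ hn']
  ring

/-- The condition `Ric_N(η^*) ≥ 0`, written out along `η`: passing from `η̇` to its positive
multiple `η^*` multiplies `Ric_N` by a positive factor. -/
theorem ricci_bound_of_weightedRicciNonneg {ψ : TM n M → ℝ} (hψ : S.IsWeight ψ)
    (hη : S.IsUnitTimelikeGeodesic η a b) {N : WithTop ℝ} {ε : ℝ} (ht : t ∈ interval a b)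
    (hRic : S.WeightedRicciNonneg ψ N (velocityStar ψ ε η t)) :
    RicciBound n N (ricci S.L (velocity η t)) (deriv (weightAlong (n := n) ψ η) t)
      (deriv (deriv (weightAlong (n := n) ψ η)) t) := by
  have hc := Real.exp_pos (2 * (1 - ε) / n * weightAlong (n := n) ψ η t)
  have h := hRic _ (isWeightedRicci_smul_velocity hψ hη ht hc N)
  have hpos : ∀ x : ℝ, (0 : EReal) ≤ ((Real.exp (2 * (1 - ε) / n *
      weightAlong (n := n) ψ η t) ^ 2 * x : ℝ) : EReal) → 0 ≤ x := fun x hx =>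
    nonneg_of_mul_nonneg_right (EReal.coe_nonneg.1 hx) (pow_pos hc 2)
  cases N with
  | top => exact hpos _ h
  | coe N =>
    simp only [RicciBound] at h ⊢
    split_ifs at h ⊢ with h1 h2
    · exact ⟨h2, hpos _ h⟩
    · exact absurd h (by simp)
    · exact hpos _ h

/-- The weighted Raychaudhuri inequality: with respect to the `ε`-proper time,
`θ_ε^* ≤ -c θ_ε²`. -/
theorem exists_hasDerivWithinAt_expansion (hn : 1 ≤ n) {ψ : TM n M → ℝ} (hψ : S.IsWeight ψ)
    {N : WithTop ℝ} (hN : N ≤ ((0 : ℝ) : WithTop ℝ) ∨ ((n : ℝ) : WithTop ℝ) ≤ N)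
    {ε : ℝ} (hε : EpsRange n N ε) (hη : S.IsUnitTimelikeGeodesic η a b)
    (hRic : ∀ t ∈ interval a b, S.WeightedRicciNonneg ψ N (velocityStar ψ ε η t))
    {J J' : S.OrthEndo η} (hJ : S.IsLagrangeTensor a b J J') {I : Set ℝ} (hI : I ⊆ interval a b)
    (hu : ∀ s ∈ I, IsUnit (J s)) (ht : t ∈ I) :
    ∃ d, HasDerivWithinAt (S.expansion ψ ε J J') d I t ∧
      d ≤ -(cConst n N ε * Real.exp (2 * (ε - 1) / n * weightAlong (n := n) ψ η t) *
        S.expansion ψ ε J J' t ^ 2) := by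
  have hti := hI ht
  have hnhds := (isOpen_interval a b).mem_nhds hti
  have hw : ContDiffAt ℝ ∞ (weightAlong (n := n) ψ η) t :=
    (contDiffOn_weightAlong hψ hη).contDiffAt hnhds
  have hw1 : HasDerivAt (weightAlong (n := n) ψ η) (deriv (weightAlong (n := n) ψ η) t) t :=
    (hw.differentiableAt (by simp)).hasDerivAt
  have hw2 : HasDerivAt (deriv (weightAlong (n := n) ψ η))
      (deriv (deriv (weightAlong (n := n) ψ η)) t) t := by
    have h : ContDiffAt ℝ ∞ (deriv (weightAlong (n := n) ψ η)) t :=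
      (hw.fderiv_right (m := ∞) (by simp)).clm_apply contDiffAt_const
    exact (h.differentiableAt (by simp)).hasDerivAt
  have hθ := hJ.1.hasDerivWithinAt_trace_endoB hη hI hu ht
  have hexp := ((hw1.const_mul (2 * (1 - ε) / n)).exp).hasDerivWithinAt (s := I)
  have hd := (hexp.mul (hθ.sub hw2.hasDerivWithinAt)).congr
    (f₁ := S.expansion ψ ε J J') (fun s hs => expansion_eq hη hn ψ ε J J' (hI hs))
    (expansion_eq hη hn ψ ε J J' hti)
  refine ⟨_, hd, ?_⟩
  have hCS := hJ.sq_trace_endoB_le hn hη hti (hu t ht)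
  have hq := weighted_quadratic_le hn hN hε
    (ricci_bound_of_weightedRicciNonneg hψ hη hti (hRic t hti))
    (LinearMap.trace ℝ _ (S.endoB J J' t) - deriv (weightAlong (n := n) ψ η) t)
  rw [expansion_eq hη hn ψ ε J J' hti]
  set E := Real.exp (2 * (1 - ε) / n * weightAlong (n := n) ψ η t) with hE
  have hEinv : Real.exp (2 * (ε - 1) / n * weightAlong (n := n) ψ η t) = E⁻¹ := by
    rw [hE, ← Real.exp_neg]; congr 1; ring
  have hE0 : 0 < E := Real.exp_pos _
  set θ := LinearMap.trace ℝ _ (S.endoB J J' t)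
  set T := LinearMap.trace ℝ _ (S.endoB J J' t * S.endoB J J' t)
  set p := deriv (weightAlong (n := n) ψ η) t
  set q := deriv (deriv (weightAlong (n := n) ψ η)) t
  set ρ := ricci S.L (velocity η t)
  rw [hEinv, show cConst n N ε * E⁻¹ * (E * (θ - p)) ^ 2 = E * (cConst n N ε * (θ - p) ^ 2) by
    field_simp]
  rw [sub_add_cancel] at hq
  have hle : -ρ - T - q + 2 * (1 - ε) / n * p * (θ - p) ≤ -(cConst n N ε * (θ - p) ^ 2) := by
    linarith
  simp only [Pi.sub_apply]
  calc _ = E * (-ρ - T - q + 2 * (1 - ε) / n * p * (θ - p)) := by ring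
    _ ≤ E * -(cConst n N ε * (θ - p) ^ 2) := mul_le_mul_of_nonneg_left hle hE0.le
    _ = _ := by ring

theorem isUnit_of_det_ne_zero {J : S.OrthEndo η} {t : ℝ} (h : LinearMap.det (J t) ≠ 0) :
    IsUnit (J t) := by
  have : FiniteDimensional ℝ (Tan n (velocity (n := n) η t).1) := finiteDimensional_tan _
  exact (LinearMap.isUnit_iff_isUnit_det _).2 (isUnit_iff_ne_zero.2 h)

end Raychaudhuri

end FinslerSpacetime

end LorentzFinsler

theorem mainTheorem10 {n : ℕ} (hn : 1 ≤ n) {M : Type*} [TopologicalSpace M] [T2Space M]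
    [SecondCountableTopology M] [ConnectedSpace M] [ChartedSpace (Model n) M]
    [IsManifold (𝓡 (n + 1)) ∞ M]
    (S : FinslerSpacetime n M) (ψ : TM n M → ℝ) (hψ : S.IsWeight ψ)
    (N : WithTop ℝ) (hN : N ≤ ((0 : ℝ) : WithTop ℝ) ∨ ((n : ℝ) : WithTop ℝ) ≤ N)
    (ε : ℝ) (hε : EpsRange n N ε)
    (a b : EReal) (η : ℝ → M) (hη : S.IsUnitTimelikeGeodesic η a b)
    (hRic : ∀ t ∈ interval a b, S.WeightedRicciNonneg ψ N (velocityStar ψ ε η t))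
    (J J' : S.OrthEndo η) (hJ : S.IsLagrangeTensor a b J J')
    (τ : ℝ → ℝ) (hτ : IsEpsProperTime ψ ε η a b τ)
    (t₀ : ℝ) (ht₀ : t₀ ∈ interval a b) (hJt₀ : IsUnit (J t₀)) :
    0 < cConst n N ε ∧
    (S.expansion ψ ε J J' t₀ < 0 → ∀ s₀ : ℝ, t₀ + s₀ ∈ interval a b →
      τ (t₀ + s₀) = τ t₀ - 1 / (cConst n N ε * S.expansion ψ ε J J' t₀) →
      ∃ t ∈ Set.Icc t₀ (t₀ + s₀), LinearMap.det (J t) = 0) ∧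
    (0 < S.expansion ψ ε J J' t₀ → ∀ s₀ : ℝ, t₀ + s₀ ∈ interval a b →
      τ (t₀ + s₀) = τ t₀ - 1 / (cConst n N ε * S.expansion ψ ε J J' t₀) →
      ∃ t ∈ Set.Icc (t₀ + s₀) t₀, LinearMap.det (J t) = 0) := by
  have hc := cConst_pos hn hN hε
  refine ⟨hc, fun hθ s₀ hs₀ hτs => ?_, fun hθ s₀ hs₀ hτs => ?_⟩
  · have hgap : cConst n N ε * (τ (t₀ + s₀) - τ t₀) = -(S.expansion ψ ε J J' t₀)⁻¹ := by
      rw [hτs]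
      have := hθ.ne
      field_simp
      ring
    -- The value `τ (t₀ + s₀)` exceeds `τ t₀`, so `s₀` cannot be negative.
    have hle : t₀ ≤ t₀ + s₀ := by
      by_contra! hlt
      have h1 := hτ.monotoneOn hs₀ ht₀ hlt.le
      have h2 := mul_nonpos_of_nonneg_of_nonpos hc.le (sub_nonpos.2 h1)
      have h3 := inv_lt_zero.2 hθ
      linarith
    by_contra! hdet
    have hI := Icc_subset_interval ht₀ hs₀
    have hd := fun t ht => exists_hasDerivWithinAt_expansion hn hψ hN hε hη hRic hJ hI
      (fun s hs => isUnit_of_det_ne_zero (hdet s hs)) (t := t) ht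
    choose! f' hf' hle' using hd
    exact (riccati_forward hc.le hle hf' (fun t ht => (hτ t (hI ht)).hasDerivWithinAt)
      (fun t _ => (Real.exp_pos _).le) hle' hθ).ne hgap
  · have hgap : cConst n N ε * (τ t₀ - τ (t₀ + s₀)) = (S.expansion ψ ε J J' t₀)⁻¹ := by
      rw [hτs]
      have := hθ.ne'
      field_simp
      ring
    -- The value `τ (t₀ + s₀)` is less than `τ t₀`, so `s₀` cannot be positive.
    have hle : t₀ + s₀ ≤ t₀ := by
      by_contra! hlt
      have h1 := hτ.monotoneOn ht₀ hs₀ hlt.le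
      have h2 := mul_nonpos_of_nonneg_of_nonpos hc.le (sub_nonpos.2 h1)
      have h3 := inv_pos.2 hθ
      linarith
    by_contra! hdet
    have hI := Icc_subset_interval hs₀ ht₀
    have hd := fun t ht => exists_hasDerivWithinAt_expansion hn hψ hN hε hη hRic hJ hI
      (fun s hs => isUnit_of_det_ne_zero (hdet s hs)) (t := t) ht
    choose! f' hf' hle' using hd
    exact (riccati_backward hc.le hle hf' (fun t ht => (hτ t (hI ht)).hasDerivWithinAt)
      (fun t _ => (Real.exp_pos _).le) hle' hθ).ne hgap
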